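/- Consider the LTI system $\dot x(t)=Ax(t)+Bu(t)$, $x(0)=X_0z_0$, $y(t)=Cx(t)+Du(t)$, $t\ge 0$, with real matrices $A\in\mathbb R^{n\times n}$, $B\in\mathbb R^{n\times m}$, $C\in\mathbb R^{p\times n}$, $D\in\mathbb R^{p\times m}$, $X_0\in\mathbb R^{n\times q}$ and $z_0\in\mathbb R^q$, and assume that it is asymptotically stable, i.e. all eigenvalues of $A$ have negative real part. Let $\alpha,\beta>0$, $1\le r<n$, and put $\tilde B:=\begin{bmatrix}B & \frac{1}{\beta\sqrt{2\alpha}}(A+\alpha I_n)X_0\end{bmatrix}$. Let $V_r,W_r\in\mathbb R^{n\times r}$ and $\eta_1\ge\dots\ge\eta_n\ge 0$ be the projection matrices and Hankel singular values obtained by balanced truncation of $[A,\tilde B,C]$ to order $r$: if $AP+PA^{\mathsf T}+\tilde B\tilde B^{\mathsf T}=0$, $A^{\mathsf T}Q+QA+C^{\mathsf T}C=0$, $P=RR^{\mathsf T}$, $Q=LL^{\mathsf T}$ with $R,L\in\mathbb R^{n\times n}$, and $L^{\mathsf T}R=U\Sigma Z^{\mathsf T}$ is a singular value decomposition with $\Sigma=\operatorname{diag}(\eta_1,\dots,\eta_n)$,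 then $V_r=RZ_r\Sigma_r^{-1/2}$ and $W_r=LU_r\Sigma_r^{-1/2}$, where $Z_r,U_r$ consist of the first $r$ columns of $Z,U$ and $\Sigma_r=\operatorname{diag}(\eta_1,\dots,\eta_r)$. Assume $\eta_r>\eta_{r+1}$ (so $\Sigma_r$ is invertible) and that $-\alpha$ is not an eigenvalue of $A_r:=W_r^{\mathsf T}AV_r$. Define $B_r:=W_r^{\mathsf T}B$, $C_r:=CV_r$, $X_{0,r}:=(A_r+\alpha I_r)^{-1}W_r^{\mathsf T}(A+\alpha I_n)X_0$, $F_r:=CX_0-C_rX_{0,r}$, and the reduced model $$\dot x_r(t)=A_rx_r(t)+B_ru(t),\quad x_r(0)=X_{0,r}z_0,\qquad y_r(t)=C_rx_r(t)+Du(t)+F_rz_0e^{-\alpha t}.$$ Then the reduced model is asymptotically stable (all eigenvalues of $A_r$ have negative real part), and for all $z_0\in\mathbb R^q$ and all locally integrable inputs $u$ one has $y_r(0)=y(0)$ and, if $u\in\mathbb L_2([0,\infty),\mathbb R^m)$, then $y-y_r\in\mathbb L_2([0,\infty),\mathbb R^p)$ and $$\|y-y_r\|_{\mathbb L_2}\le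 2(\eta_{r+1}+\dots+\eta_n)\left(\|u\|_{\mathbb L_2}+\beta\|z_0\|_2\right).$$ -/

import Mathlib

open Matrix MeasureTheory

noncomputable section

namespace ShiftBT

/-- Asymptotic stability of `ẋ = A x + B u`: all complex eigenvalues of the real matrix `A`
lie in the open left half-plane. -/
def IsAsymptoticallyStable {n : ℕ} (A : Matrix (Fin n) (Fin n) ℝ) : Prop :=
  ∀ μ : ℂ, Module.End.HasEigenvalue (Matrix.toLin' (A.map Complex.ofReal)) μ → μ.re < 0

/-- `P` solves the controllability Lyapunov equation (the solution is unique for stable `A`). -/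
def IsControllabilityGramian {n : ℕ} {ι : Type*} [Fintype ι] (A : Matrix (Fin n) (Fin n) ℝ)
    (B : Matrix (Fin n) ι ℝ) (P : Matrix (Fin n) (Fin n) ℝ) : Prop :=
  A * P + P * Aᵀ + B * Bᵀ = 0

/-- `Q` solves the observability Lyapunov equation (the solution is unique for stable `A`). -/
def IsObservabilityGramian {n : ℕ} {ι : Type*} [Fintype ι] (A : Matrix (Fin n) (Fin n) ℝ)
    (C : Matrix ι (Fin n) ℝ) (Q : Matrix (Fin n) (Fin n) ℝ) : Prop :=
  Aᵀ * Q + Q * A + Cᵀ * C = 0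

/-- The first `r` columns of a square matrix. -/
def leadingCols {n r : ℕ} (hr : r ≤ n) (M : Matrix (Fin n) (Fin n) ℝ) :
    Matrix (Fin n) (Fin r) ℝ :=
  M.submatrix id (Fin.castLE hr)

/-- `[V, W, η₁, …, ηₙ]` is a result of square-root balanced truncation of `[A, B, C]` to order `r`:
with Gramians `P = R Rᵀ`, `Q = L Lᵀ` and a singular value decomposition `Lᵀ R = U Σ Zᵀ`,
`Σ = diag(η₁ ≥ … ≥ ηₙ ≥ 0)`, one has `V = R Z_r Σ_r^{-1/2}` and `W = L U_r Σ_r^{-1/2}`.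
The `ηᵢ` are the Hankel singular values (the square roots of the eigenvalues of `P Q`);
`η i` with `i : Fin n` is the `(i+1)`-st one. The projection matrices are not unique, hence a
relation. It is meant for `η_r > 0`, so that `Σ_r` is invertible. Low-rank factors of the Gramians
are covered by padding them with zero columns. -/
def IsBalancedTruncation {n r : ℕ} {ι κ : Type*} [Fintype ι] [Fintype κ]
    (A : Matrix (Fin n) (Fin n) ℝ) (B : Matrix (Fin n) ι ℝ) (C : Matrix κ (Fin n) ℝ)
    (hr : r ≤ n) (V W : Matrix (Fin n) (Fin r) ℝ) (η : Fin n → ℝ) : Prop :=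
  Antitone η ∧ (∀ i, 0 ≤ η i) ∧
  ∃ P Q R L U Z : Matrix (Fin n) (Fin n) ℝ,
    IsControllabilityGramian A B P ∧ IsObservabilityGramian A C Q ∧
    P = R * Rᵀ ∧ Q = L * Lᵀ ∧
    U ∈ Matrix.orthogonalGroup (Fin n) ℝ ∧ Z ∈ Matrix.orthogonalGroup (Fin n) ℝ ∧
    Lᵀ * R = U * Matrix.diagonal η * Zᵀ ∧
    V = R * leadingCols hr Z *
      Matrix.diagonal (fun i : Fin r => (Real.sqrt (η (Fin.castLE hr i)))⁻¹) ∧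
    W = L * leadingCols hr U *
      Matrix.diagonal (fun i : Fin r => (Real.sqrt (η (Fin.castLE hr i)))⁻¹)

/-- The expanded input matrix `[B, (A + α I) X₀ / (β √(2α))]`. -/
def expandedInput {n m q : ℕ} (A : Matrix (Fin n) (Fin n) ℝ) (B : Matrix (Fin n) (Fin m) ℝ)
    (X₀ : Matrix (Fin n) (Fin q) ℝ) (α β : ℝ) : Matrix (Fin n) (Fin m ⊕ Fin q) ℝ :=
  Matrix.fromCols B ((1 / (β * Real.sqrt (2 * α))) • ((A + α • (1 : Matrix (Fin n) (Fin n) ℝ)) * X₀))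

/-- A model `ẋ_r = A x_r + B u`, `x_r(0) = X₀ z₀`, `y_r = C x_r + D u + f`, where the output
correction `f z₀ t` may depend on `z₀`. -/
structure ReducedModel (r m p q : ℕ) where
  A : Matrix (Fin r) (Fin r) ℝ
  B : Matrix (Fin r) (Fin m) ℝ
  C : Matrix (Fin p) (Fin r) ℝ
  D : Matrix (Fin p) (Fin m) ℝ
  X₀ : Matrix (Fin r) (Fin q) ℝ
  f : (Fin q → ℝ) → ℝ → (Fin p → ℝ)

/-- The modified initial map `(A_r + α I)⁻¹ Wᵀ (A + α I) X₀`, with `A_r = Wᵀ A V`. -/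
def reducedInitialMap {n q r : ℕ} (A : Matrix (Fin n) (Fin n) ℝ) (X₀ : Matrix (Fin n) (Fin q) ℝ)
    (α : ℝ) (V W : Matrix (Fin n) (Fin r) ℝ) : Matrix (Fin r) (Fin q) ℝ :=
  (Wᵀ * A * V + α • (1 : Matrix (Fin r) (Fin r) ℝ))⁻¹ *
    (Wᵀ * (A + α • (1 : Matrix (Fin n) (Fin n) ℝ)) * X₀)

/-- The jShiftBT reduced model defined by projection matrices `V`, `W`. -/
def jShiftBT {n m p q r : ℕ} (A : Matrix (Fin n) (Fin n) ℝ) (B : Matrix (Fin n) (Fin m) ℝ)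
    (C : Matrix (Fin p) (Fin n) ℝ) (D : Matrix (Fin p) (Fin m) ℝ)
    (X₀ : Matrix (Fin n) (Fin q) ℝ) (α : ℝ) (V W : Matrix (Fin n) (Fin r) ℝ) :
    ReducedModel r m p q where
  A := Wᵀ * A * V
  B := Wᵀ * B
  C := C * V
  D := D
  X₀ := reducedInitialMap A X₀ α V W
  f := fun z₀ t =>
    Real.exp (-α * t) • ((C * X₀ - (C * V) * reducedInitialMap A X₀ α V W) *ᵥ z₀)

/-- `x` is the (Carathéodory) solution on `[0, ∞)` of `ẋ = A x + B u`, `x(0) = x₀`. -/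
def IsStateTrajectory {n m : ℕ} (A : Matrix (Fin n) (Fin n) ℝ) (B : Matrix (Fin n) (Fin m) ℝ)
    (u : ℝ → (Fin m → ℝ)) (x₀ : Fin n → ℝ) (x : ℝ → (Fin n → ℝ)) : Prop :=
  ContinuousOn x (Set.Ici 0) ∧
  ∀ t, 0 ≤ t →
    IntervalIntegrable (fun s => A *ᵥ x s + B *ᵥ u s) volume 0 t ∧
    x t = x₀ + ∫ s in (0 : ℝ)..t, (A *ᵥ x s + B *ᵥ u s)

/-- `g ∈ 𝕃₂ᵏ`, square integrability on `[0, ∞)`. -/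
def MemL2 {k : ℕ} (g : ℝ → (Fin k → ℝ)) : Prop :=
  AEStronglyMeasurable g (volume.restrict (Set.Ici 0)) ∧
  IntegrableOn (fun t => g t ⬝ᵥ g t) (Set.Ici 0) volume

/-- `‖g‖_{𝕃₂} = (∫₀^∞ g(t)ᵀ g(t) dt)^{1/2}`. -/
def normL2 {k : ℕ} (g : ℝ → (Fin k → ℝ)) : ℝ :=
  Real.sqrt (∫ t in Set.Ici (0 : ℝ), g t ⬝ᵥ g t)

end ShiftBT

end

namespace ShiftBT

/-! The shifted state `x - e^{-αt} X₀ z₀` starts at zero and is driven through the expanded input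
matrix by `w = [u; β√(2α) e^{-αt} z₀]`. The reduced initial map satisfies `(A_r + α I) X_{0,r} = Wᵀ
(A + α I) X₀`, so `x_r - e^{-αt} X_{0,r} z₀` is exactly the balanced-truncation state for the same
`w`. The feedthrough cancels and the `F_r` term absorbs the exponentials, so `y - y_r` is the output
error of ordinary balanced truncation with zero initial states. Its gain is at most `2 (η_{r+1} + …
+ η_n)`, and `‖w‖² = ‖u‖² + β²‖z₀‖² ≤ (‖u‖ + β‖z₀‖)²`.

The gain is bounded in the time domain. For a balanced system with Gramian `Σ`, of which the last
state (singular value `σ`) is dropped, let `E` embed the reduced state `v`. The storage function `(x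
- Ev)ᵀ Σ (x - Ev) + σ² (x + Ev)ᵀ Σ⁻¹ (x + Ev)` grows at rate at most `4σ²|u|² - |error|²`
(`dissipation_pointwise`). States are removed one at a time and the errors summed by Minkowski's
inequality. States with zero singular value are removed at no cost, because reachable states
annihilate `ker P` (`IsZeroTrajectory.mulVec_eq_zero`). Everything happens on `[0, T]`, so this
bound needs no stability, in particular none of the intermediate models; finally `T → ∞`.

Stability of `A_r` is separate. The reduced Lyapunov equations leave only imaginary eigenvalues to
exclude. For such an eigenvalue the eigenspace is invariant under `Σ_r²`, and the gap `η_r >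
η_{r+1}` lifts a common eigenvector to an eigenvector of `A`, which is impossible. -/

/-- `x` is the primitive of the locally integrable function `g` on `[0, ∞)` with `x 0 = 0`. -/
def IsPrimitive {ν : Type*} [Fintype ν] (g x : ℝ → ν → ℝ) : Prop :=
  ContinuousOn x (Set.Ici 0) ∧
  ∀ t, 0 ≤ t → IntervalIntegrable g volume 0 t ∧ x t = ∫ s in (0 : ℝ)..t, g s

/-- `x` is the solution of `ẋ = A x + B u`, `x 0 = 0`, for arbitrary finite index types. -/
def IsZeroTrajectory {ν ι : Type*} [Fintype ν] [Fintype ι] (A : Matrix ν ν ℝ) (B : Matrix ν ι ℝ)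
    (u : ℝ → ι → ℝ) (x : ℝ → ν → ℝ) : Prop :=
  IsPrimitive (fun s => A *ᵥ x s + B *ᵥ u s) x

/-! ### Calculus of primitives of locally integrable functions -/

section Primitive

variable {ν κ : Type*} [Fintype ν] [Fintype κ]

theorem intervalIntegrable_pi_iff {g : ℝ → ν → ℝ} {a b : ℝ} :
    IntervalIntegrable g volume a b ↔ ∀ i, IntervalIntegrable (fun t => g t i) volume a b := by
  simp only [intervalIntegrable_iff, IntegrableOn]
  exact ⟨fun h i => h.eval i, fun h => Integrable.of_eval h⟩

theorem intervalIntegral_apply {g : ℝ → ν → ℝ} {a b : ℝ}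
    (hg : IntervalIntegrable g volume a b) (i : ν) :
    (∫ s in a..b, g s) i = ∫ s in a..b, g s i :=
  ((ContinuousLinearMap.proj (R := ℝ) (φ := fun _ : ν => ℝ) i).intervalIntegral_comp_comm hg).symm

theorem IsPrimitive.clm_comp {g x : ℝ → ν → ℝ} (h : IsPrimitive g x)
    (f : (ν → ℝ) →L[ℝ] (κ → ℝ)) : IsPrimitive (fun t => f (g t)) (fun t => f (x t)) := by
  refine ⟨f.continuous.comp_continuousOn h.1, fun t ht => ?_⟩
  obtain ⟨h1, h2⟩ := h.2 t ht
  have h3 : IntervalIntegrable (fun t => f (g t)) volume 0 t :=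
    ⟨f.integrable_comp h1.1, f.integrable_comp h1.2⟩
  exact ⟨h3, by simp only [h2, f.intervalIntegral_comp_comm h1]⟩

theorem IsPrimitive.mulVec {g x : ℝ → ν → ℝ} (h : IsPrimitive g x) (M : Matrix κ ν ℝ) :
    IsPrimitive (fun t => M *ᵥ g t) (fun t => M *ᵥ x t) :=
  h.clm_comp (LinearMap.toContinuousLinearMap M.mulVecLin)

theorem IsPrimitive.add {g x g' x' : ℝ → ν → ℝ} (h : IsPrimitive g x) (h' : IsPrimitive g' x') :
    IsPrimitive (fun t => g t + g' t) (fun t => x t + x' t) := by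
  refine ⟨h.1.add h'.1, fun t ht => ⟨(h.2 t ht).1.add (h'.2 t ht).1, ?_⟩⟩
  simp only [intervalIntegral.integral_add (h.2 t ht).1 (h'.2 t ht).1, (h.2 t ht).2, (h'.2 t ht).2]

theorem IsPrimitive.sub {g x g' x' : ℝ → ν → ℝ} (h : IsPrimitive g x) (h' : IsPrimitive g' x') :
    IsPrimitive (fun t => g t - g' t) (fun t => x t - x' t) := by
  refine ⟨h.1.sub h'.1, fun t ht => ⟨(h.2 t ht).1.sub (h'.2 t ht).1, ?_⟩⟩
  simp only [intervalIntegral.integral_sub (h.2 t ht).1 (h'.2 t ht).1, (h.2 t ht).2, (h'.2 t ht).2]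

theorem IsPrimitive.congr {g g' x x' : ℝ → ν → ℝ} (h : IsPrimitive g x)
    (hg : ∀ t, 0 ≤ t → g' t = g t) (hx : ∀ t, 0 ≤ t → x' t = x t) : IsPrimitive g' x' := by
  refine ⟨h.1.congr fun t ht => hx t ht, fun t ht => ?_⟩
  have e : Set.EqOn g g' (Set.uIoc 0 t) := fun s hs => by
    rw [Set.uIoc_of_le ht] at hs
    exact (hg s hs.1.le).symm
  refine ⟨(h.2 t ht).1.congr e, ?_⟩
  rw [hx t ht, (h.2 t ht).2]
  refine intervalIntegral.integral_congr fun s hs => ?_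
  rw [Set.uIcc_of_le ht] at hs
  exact (hg s hs.1).symm

/-- Product rule, in integral form, for primitives of integrable functions. -/
theorem integral_mul_primitive {f g F G : ℝ → ℝ} {T : ℝ} (hT : 0 ≤ T)
    (hf : IntervalIntegrable f volume 0 T) (hg : IntervalIntegrable g volume 0 T)
    (hF : ∀ t ∈ Set.Icc 0 T, F t = ∫ s in (0 : ℝ)..t, f s)
    (hG : ∀ t ∈ Set.Icc 0 T, G t = ∫ s in (0 : ℝ)..t, g s) :
    F T * G T = ∫ s in (0 : ℝ)..T, (f s * G s + F s * g s) := by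
  have h0 : (0 : ℝ) ∈ Set.uIcc 0 T := by simp
  -- The primitives are only absolutely continuous, so integration by parts is used in that class
  -- and derivatives are identified almost everywhere.
  have key := (hf.absolutelyContinuousOnInterval_intervalIntegral h0).integral_deriv_mul_eq_sub
    (hg.absolutelyContinuousOnInterval_intervalIntegral h0)
  simp only [intervalIntegral.integral_same, mul_zero, sub_zero] at key
  rw [hF T ⟨hT, le_rfl⟩, hG T ⟨hT, le_rfl⟩, ← key]
  refine intervalIntegral.integral_congr_ae ?_
  filter_upwards [hf.ae_hasDerivAt_integral, hg.ae_hasDerivAt_integral] with t h1 h2 ht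
  have ht' := Set.uIoc_subset_uIcc ht
  have ht'' : t ∈ Set.Icc 0 T := by rwa [Set.uIcc_of_le hT] at ht'
  rw [(h1 ht' 0 h0).deriv, (h2 ht' 0 h0).deriv, hF t ht'', hG t ht'']

theorem IsPrimitive.continuousOn_uIcc {g x : ℝ → ν → ℝ} (h : IsPrimitive g x) {T : ℝ}
    (hT : 0 ≤ T) : ContinuousOn x (Set.uIcc 0 T) :=
  h.1.mono (by rw [Set.uIcc_of_le hT]; exact Set.Icc_subset_Ici_self)

theorem intervalIntegrable_dotProduct {g x : ℝ → ν → ℝ} {a b : ℝ}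
    (hg : IntervalIntegrable g volume a b) (hx : ContinuousOn x (Set.uIcc a b)) :
    IntervalIntegrable (fun t => x t ⬝ᵥ g t) volume a b := by
  have : (fun t => x t ⬝ᵥ g t) = ∑ i, fun t => x t i * g t i := by
    ext t; simp [dotProduct]
  rw [this]
  refine IntervalIntegrable.sum _ fun i _ => ?_
  exact (intervalIntegrable_pi_iff.1 hg i).continuousOn_mul (continuousOn_pi.1 hx i)

theorem IsPrimitive.dotProduct_eq_integral {g x h y : ℝ → ν → ℝ} (hx : IsPrimitive g x)
    (hy : IsPrimitive h y) {T : ℝ} (hT : 0 ≤ T) :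
    x T ⬝ᵥ y T = ∫ s in (0 : ℝ)..T, (y s ⬝ᵥ g s + x s ⬝ᵥ h s) := by
  have hgi := intervalIntegrable_pi_iff.1 (hx.2 T hT).1
  have hhi := intervalIntegrable_pi_iff.1 (hy.2 T hT).1
  have e : (fun s => y s ⬝ᵥ g s + x s ⬝ᵥ h s)
      = fun s => ∑ i, (g s i * y s i + x s i * h s i) := by
    ext s; simp [dotProduct, Finset.sum_add_distrib, mul_comm]
  rw [e, intervalIntegral.integral_finsetSum]
  · refine Finset.sum_congr rfl fun i _ => ?_
    refine integral_mul_primitive (F := fun t => x t i) (G := fun t => y t i) hT (hgi i) (hhi i)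
      (fun t ht => ?_) (fun t ht => ?_)
    · rw [(hx.2 t ht.1).2, intervalIntegral_apply (hx.2 t ht.1).1]
    · rw [(hy.2 t ht.1).2, intervalIntegral_apply (hy.2 t ht.1).1]
  · intro i _
    exact ((hgi i).mul_continuousOn (continuousOn_pi.1 (hy.continuousOn_uIcc hT) i)).add
      ((hhi i).continuousOn_mul (continuousOn_pi.1 (hx.continuousOn_uIcc hT) i))

theorem IsPrimitive.quadratic_eq_integral {g x : ℝ → ν → ℝ} (hx : IsPrimitive g x)
    {S : Matrix ν ν ℝ} (hS : Sᵀ = S) {T : ℝ} (hT : 0 ≤ T) :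
    x T ⬝ᵥ S *ᵥ x T = ∫ s in (0 : ℝ)..T, 2 * (x s ⬝ᵥ S *ᵥ g s) := by
  rw [hx.dotProduct_eq_integral (hx.mulVec S) hT]
  refine intervalIntegral.integral_congr fun s _ => ?_
  have : S *ᵥ x s ⬝ᵥ g s = x s ⬝ᵥ S *ᵥ g s := by
    rw [dotProduct_mulVec, ← mulVec_transpose, hS]
  simp only [this]
  ring

end Primitive

/-! ### The dissipation inequality behind the error bound -/

section Dissipation

variable {ν κ ι o : Type*} [Fintype ν] [Fintype κ] [Fintype ι] [Fintype o]

theorem dotProduct_self_nonneg_real (v : ν → ℝ) : 0 ≤ v ⬝ᵥ v :=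
  Finset.sum_nonneg fun i _ => mul_self_nonneg (v i)

theorem two_mul_quadratic_eq {A S N : Matrix ν ν ℝ} (hS : Sᵀ = S)
    (h : Aᵀ * S + S * A + N = 0) (z : ν → ℝ) :
    2 * (z ⬝ᵥ S *ᵥ (A *ᵥ z)) = -(z ⬝ᵥ N *ᵥ z) := by
  have h1 : z ⬝ᵥ (Aᵀ * S + S * A + N) *ᵥ z = 0 := by rw [h]; simp
  have h2 : z ⬝ᵥ Aᵀ *ᵥ (S *ᵥ z) = z ⬝ᵥ S *ᵥ (A *ᵥ z) := by
    conv_rhs => rw [dotProduct_mulVec, ← mulVec_transpose, hS, dotProduct_mulVec,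
      ← mulVec_transpose, dotProduct_comm]
  simp only [add_mulVec, dotProduct_add, ← mulVec_mulVec, h2] at h1
  linarith

theorem dotProduct_transpose_mul_self_mulVec (C : Matrix o ν ℝ) (z : ν → ℝ) :
    z ⬝ᵥ (Cᵀ * C) *ᵥ z = (C *ᵥ z) ⬝ᵥ (C *ᵥ z) := by
  rw [← mulVec_mulVec, dotProduct_mulVec, vecMul_transpose]

/-- With `w = AEv + Bu`, the difference `z = x - Ev` has velocity `Az + (1 - EF)w` and the sum `s =
x + Ev` has velocity `As + 2Bu - (1 - EF)w`. The residual terms see only `x` by `hEQ` and `hES`, and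
then cancel by `hcross`. The Lyapunov equations turn the rest into `-|Cz|²` and `σ² (4|u|² - |BᵀSs -
2u|²)`. -/
theorem dissipation_pointwise [DecidableEq ν] {A Q S : Matrix ν ν ℝ} {B : Matrix ν ι ℝ} {C : Matrix o ν ℝ}
    {E : Matrix ν κ ℝ} {F : Matrix κ ν ℝ} {σ : ℝ}
    (hQ : Qᵀ = Q) (hS : Sᵀ = S)
    (hobs : Aᵀ * Q + Q * A + Cᵀ * C = 0) (hctr : Aᵀ * S + S * A + S * B * Bᵀ * S = 0)
    (hEQ : Eᵀ * Q * (1 - E * F) = 0) (hES : Eᵀ * S * (1 - E * F) = 0)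
    (x : ν → ℝ) (v : κ → ℝ) (u : ι → ℝ)
    (hcross : x ᵥ* (Q * (1 - E * F)) = σ ^ 2 • (x ᵥ* (S * (1 - E * F)))) :
    2 * ((x - E *ᵥ v) ⬝ᵥ Q *ᵥ (A *ᵥ x + B *ᵥ u - E *ᵥ ((F * A * E) *ᵥ v + (F * B) *ᵥ u)))
      + σ ^ 2 * (2 * ((x + E *ᵥ v) ⬝ᵥ
          S *ᵥ (A *ᵥ x + B *ᵥ u + E *ᵥ ((F * A * E) *ᵥ v + (F * B) *ᵥ u))))
      ≤ 4 * σ ^ 2 * (u ⬝ᵥ u) - (C *ᵥ x - (C * E) *ᵥ v) ⬝ᵥ (C *ᵥ x - (C * E) *ᵥ v) := by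
  set z := x - E *ᵥ v with hz
  set s := x + E *ᵥ v with hs
  set w := A *ᵥ (E *ᵥ v) + B *ᵥ u with hw
  have e1 : A *ᵥ x + B *ᵥ u - E *ᵥ ((F * A * E) *ᵥ v + (F * B) *ᵥ u)
      = A *ᵥ z + (1 - E * F) *ᵥ w := by
    simp only [hz, hw, sub_mulVec, one_mulVec, mulVec_add, mulVec_sub, ← mulVec_mulVec]
    abel
  have e2 : A *ᵥ x + B *ᵥ u + E *ᵥ ((F * A * E) *ᵥ v + (F * B) *ᵥ u)
      = A *ᵥ s + (2 : ℝ) • (B *ᵥ u) - (1 - E * F) *ᵥ w := by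
    simp only [hs, hw, sub_mulVec, one_mulVec, mulVec_add, ← mulVec_mulVec, two_smul]
    abel
  have e3 : C *ᵥ x - (C * E) *ᵥ v = C *ᵥ z := by
    simp only [hz, mulVec_sub, ← mulVec_mulVec]
  have hE : ∀ M : Matrix ν ν ℝ, Eᵀ * M * (1 - E * F) = 0 →
      (E *ᵥ v) ⬝ᵥ M *ᵥ ((1 - E * F) *ᵥ w) = 0 := by
    intro M hM
    rw [← vecMul_transpose E v, ← dotProduct_mulVec, mulVec_mulVec, mulVec_mulVec, hM]
    simp
  have hx : x ⬝ᵥ Q *ᵥ ((1 - E * F) *ᵥ w) = σ ^ 2 * (x ⬝ᵥ S *ᵥ ((1 - E * F) *ᵥ w)) := by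
    rw [mulVec_mulVec, mulVec_mulVec, dotProduct_mulVec, dotProduct_mulVec, hcross,
      smul_dotProduct, smul_eq_mul]
  have hzQ : z ⬝ᵥ Q *ᵥ ((1 - E * F) *ᵥ w) = x ⬝ᵥ Q *ᵥ ((1 - E * F) *ᵥ w) := by
    rw [hz, sub_dotProduct, hE Q hEQ, sub_zero]
  have hsS : s ⬝ᵥ S *ᵥ ((1 - E * F) *ᵥ w) = x ⬝ᵥ S *ᵥ ((1 - E * F) *ᵥ w) := by
    rw [hs, add_dotProduct, hE S hES, add_zero]
  have q1 := two_mul_quadratic_eq hQ hobs z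
  rw [dotProduct_transpose_mul_self_mulVec] at q1
  have q2 := two_mul_quadratic_eq hS hctr s
  have e4 : S * B * Bᵀ * S = (Bᵀ * S)ᵀ * (Bᵀ * S) := by
    rw [transpose_mul, transpose_transpose, hS, Matrix.mul_assoc]
  rw [e4, dotProduct_transpose_mul_self_mulVec] at q2
  have e5 : s ⬝ᵥ S *ᵥ (B *ᵥ u) = ((Bᵀ * S) *ᵥ s) ⬝ᵥ u := by
    rw [mulVec_mulVec, dotProduct_mulVec, ← mulVec_transpose, transpose_mul, hS]
  have q3 := dotProduct_self_nonneg_real ((Bᵀ * S) *ᵥ s - (2 : ℝ) • u)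
  simp only [sub_dotProduct, dotProduct_sub, smul_dotProduct, dotProduct_smul, smul_eq_mul,
    dotProduct_comm u ((Bᵀ * S) *ᵥ s)] at q3
  rw [e1, e2, e3]
  simp only [mulVec_add, mulVec_sub, mulVec_smul, dotProduct_add, dotProduct_sub, dotProduct_smul,
    smul_eq_mul, hzQ, hsS, hx, e5]
  nlinarith [mul_nonneg (sq_nonneg σ) q3]

/-- The storage function vanishes at time `0` and is nonnegative at `T`, so integrating the
pointwise inequality suffices. The cross condition is asked only along the trajectory, which allows
the singular case `S = 0`, `σ = 0`. -/
theorem IsZeroTrajectory.integral_output_error_le [DecidableEq ν]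
    {A Q S : Matrix ν ν ℝ} {B : Matrix ν ι ℝ}
    {C : Matrix o ν ℝ} {E : Matrix ν κ ℝ} {F : Matrix κ ν ℝ} {σ : ℝ}
    (hQ : Q.PosSemidef) (hS : S.PosSemidef)
    (hobs : Aᵀ * Q + Q * A + Cᵀ * C = 0) (hctr : Aᵀ * S + S * A + S * B * Bᵀ * S = 0)
    (hEQ : Eᵀ * Q * (1 - E * F) = 0) (hES : Eᵀ * S * (1 - E * F) = 0)
    {u : ℝ → ι → ℝ} {x : ℝ → ν → ℝ} {v : ℝ → κ → ℝ}
    (hx : IsZeroTrajectory A B u x) (hv : IsZeroTrajectory (F * A * E) (F * B) u v)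
    (hcross : ∀ t, 0 ≤ t →
      x t ᵥ* (Q * (1 - E * F)) = σ ^ 2 • (x t ᵥ* (S * (1 - E * F))))
    {T : ℝ} (hT : 0 ≤ T) (hu : IntervalIntegrable (fun t => u t ⬝ᵥ u t) volume 0 T) :
    ∫ t in (0 : ℝ)..T, (C *ᵥ x t - (C * E) *ᵥ v t) ⬝ᵥ (C *ᵥ x t - (C * E) *ᵥ v t)
      ≤ 4 * σ ^ 2 * ∫ t in (0 : ℝ)..T, u t ⬝ᵥ u t := by
  have hQ' : Qᵀ = Q := by simpa [IsHermitian] using hQ.1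
  have hS' : Sᵀ = S := by simpa [IsHermitian] using hS.1
  have hz := IsPrimitive.sub hx (IsPrimitive.mulVec hv E)
  have hs := IsPrimitive.add hx (IsPrimitive.mulVec hv E)
  have vz := hz.quadratic_eq_integral hQ' hT
  have vs := hs.quadratic_eq_integral hS' hT
  have iz : IntervalIntegrable _ volume 0 T :=
    (intervalIntegrable_dotProduct ((hz.mulVec Q).2 T hT).1 (hz.continuousOn_uIcc hT)).const_mul 2
  have is' : IntervalIntegrable _ volume 0 T :=
    ((intervalIntegrable_dotProduct ((hs.mulVec S).2 T hT).1
      (hs.continuousOn_uIcc hT)).const_mul 2).const_mul (σ ^ 2)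
  have ie : IntervalIntegrable (fun t => (C *ᵥ x t - (C * E) *ᵥ v t) ⬝ᵥ
      (C *ᵥ x t - (C * E) *ᵥ v t)) volume 0 T := by
    have hc : ContinuousOn (fun t => C *ᵥ x t - (C * E) *ᵥ v t) (Set.uIcc 0 T) :=
      ((IsPrimitive.mulVec hx C).continuousOn_uIcc hT).sub
        ((IsPrimitive.mulVec hv (C * E)).continuousOn_uIcc hT)
    exact intervalIntegrable_dotProduct hc.intervalIntegrable hc
  have key := intervalIntegral.integral_mono_on hT (iz.add is') ((hu.const_mul (4 * σ ^ 2)).sub ie)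
    (fun t ht => dissipation_pointwise hQ' hS' hobs hctr hEQ hES (x t) (v t) (u t)
      (hcross t ht.1))
  rw [intervalIntegral.integral_add iz is', intervalIntegral.integral_sub (hu.const_mul _) ie,
    ← vz, intervalIntegral.integral_const_mul, ← vs, intervalIntegral.integral_const_mul] at key
  have p1 := hQ.dotProduct_mulVec_nonneg (x T - E *ᵥ v T)
  have p2 := hS.dotProduct_mulVec_nonneg (x T + E *ᵥ v T)
  simp only [star_trivial] at p1 p2
  have p3 := mul_nonneg (sq_nonneg σ) p2
  linarith

end Dissipation

/-! ### Existence, uniqueness and reachability for linear systems -/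

section Solutions

variable {ν κ ι : Type*} [Fintype ν] [Fintype ι]

theorem isPrimitive_integral {g : ℝ → ν → ℝ}
    (hg : ∀ t, 0 ≤ t → IntervalIntegrable g volume 0 t) :
    IsPrimitive g (fun t => ∫ s in (0 : ℝ)..t, g s) := by
  refine ⟨?_, fun t ht => ⟨hg t ht, rfl⟩⟩
  -- Extension by zero makes the integrand locally integrable on the whole line, where primitives
  -- are known to be continuous.
  set f : ℝ → ν → ℝ := (Set.Ioi 0).indicator g with hf
  have hf0 : ∀ t, IntervalIntegrable f volume 0 t := by
    intro t
    rcases le_total 0 t with ht | ht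
    · refine (hg t ht).congr fun s hs => ?_
      rw [Set.uIoc_of_le ht] at hs
      simp [hf, hs.1]
    · refine (intervalIntegrable_const (c := (0 : ν → ℝ))).congr fun s hs => ?_
      rw [Set.uIoc_of_ge ht] at hs
      simp [hf, hs.2]
  refine (intervalIntegral.continuous_primitive
    (fun a b => (hf0 a).symm.trans (hf0 b)) 0).continuousOn.congr fun t ht => ?_
  refine intervalIntegral.integral_congr_ae (ae_of_all _ fun s hs => ?_)
  rw [Set.uIoc_of_le ht] at hs
  simp [hf, hs.1]

theorem IsPrimitive.continuous_comp_max {g x : ℝ → ν → ℝ} (h : IsPrimitive g x) :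
    Continuous fun t => x (max 0 t) :=
  h.1.comp_continuous (by fun_prop) fun t => le_max_left 0 t

/-- Grönwall's inequality. Freezing `x` at `x 0` for negative times makes the integrand continuous,
so `x` is differentiable from the right. -/
theorem IsPrimitive.eq_zero_of_linear {A : Matrix ν ν ℝ} {x : ℝ → ν → ℝ}
    (h : IsPrimitive (fun s => A *ᵥ x s) x) {t : ℝ} (ht : 0 ≤ t) : x t = 0 := by
  set a := LinearMap.toContinuousLinearMap A.mulVecLin with ha
  have hc : Continuous fun t => a (x (max 0 t)) := a.continuous.comp h.continuous_comp_max
  have hx : ∀ s, 0 ≤ s → x s = ∫ τ in (0 : ℝ)..s, a (x (max 0 τ)) := by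
    intro s hs
    rw [(h.2 s hs).2]
    refine intervalIntegral.integral_congr fun τ hτ => ?_
    rw [Set.uIcc_of_le hs] at hτ
    simp [ha, max_eq_right hτ.1]
  refine eq_zero_of_abs_deriv_le_mul_abs_self_of_eq_zero_right (a := 0) (b := t) (K := ‖a‖)
    (f' := fun s => a (x s)) (h.1.mono Set.Icc_subset_Ici_self) (fun s hs => ?_)
    (by rw [hx 0 le_rfl]; simp) (fun s _ => a.le_opNorm _) t ⟨ht, le_rfl⟩
  have hd := (hc.integral_hasStrictDerivAt 0 s).hasDerivAt
  rw [max_eq_right hs.1] at hd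
  exact hd.hasDerivWithinAt.congr (fun r hr => hx r (hs.1.trans hr)) (hx s hs.1)

/-- The input is merely integrable, so its primitive `h = B ∫ u` is split off: the remainder solves
`ẇ = A w + A h` with continuous forcing, and variation of constants gives a classical solution. -/
theorem exists_isZeroTrajectory (A : Matrix ν ν ℝ) (B : Matrix ν ι ℝ) {u : ℝ → ι → ℝ}
    (hu : ∀ t, 0 ≤ t → IntervalIntegrable u volume 0 t) :
    ∃ x, IsZeroTrajectory A B u x := by
  let _ : NormedAlgebra ℚ ((ν → ℝ) →L[ℝ] (ν → ℝ)) := NormedAlgebra.restrictScalars ℚ ℝ _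
  have hh := (isPrimitive_integral hu).mulVec B
  set h : ℝ → ν → ℝ := fun t => B *ᵥ ∫ s in (0 : ℝ)..t, u s with hh'
  set a := LinearMap.toContinuousLinearMap A.mulVecLin with ha
  have hc : Continuous fun t => a (h (max 0 t)) := a.continuous.comp hh.continuous_comp_max
  have hexp : ∀ t : ℝ, HasDerivAt (fun t : ℝ => NormedSpace.exp (t • a))
      (a * NormedSpace.exp (t • a)) t := fun t => hasDerivAt_exp_smul_const' a t
  have hexpc : Continuous fun t : ℝ => NormedSpace.exp (t • a) :=
    continuous_iff_continuousAt.2 fun t => (hexp t).continuousAt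
  have hinv : ∀ t : ℝ, NormedSpace.exp (t • a) * NormedSpace.exp ((-t) • a) = 1 := fun t => by
    rw [← NormedSpace.exp_add_of_commute ((Commute.refl a).smul_left t |>.smul_right (-t)),
      ← add_smul]
    simp
  have hcc : Continuous fun s : ℝ => NormedSpace.exp ((-s) • a) (a (h (max 0 s))) :=
    (hexpc.comp continuous_neg).clm_apply hc
  set w : ℝ → ν → ℝ := fun t => NormedSpace.exp (t • a)
    (∫ s in (0 : ℝ)..t, NormedSpace.exp ((-s) • a) (a (h (max 0 s)))) with hw
  have hwd : ∀ t, HasDerivAt w (a (w t) + a (h (max 0 t))) t := by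
    intro t
    have := (hexp t).clm_apply (hcc.integral_hasStrictDerivAt 0 t).hasDerivAt
    refine this.congr_deriv ?_
    have e := congrArg (fun f => f (a (h (max 0 t)))) (hinv t)
    simp only [mul_apply_eq_comp, one_apply_eq_self] at e
    rw [mul_apply_eq_comp, e]
  have hwc : Continuous w := continuous_iff_continuousAt.2 fun t => (hwd t).continuousAt
  have hdc : Continuous fun t => a (w t) + a (h (max 0 t)) := (a.continuous.comp hwc).add hc
  have hwp : IsPrimitive (fun t => a (w t) + a (h (max 0 t))) w := by
    refine ⟨hwc.continuousOn, fun t _ => ⟨hdc.intervalIntegrable _ _, ?_⟩⟩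
    rw [intervalIntegral.integral_eq_sub_of_hasDerivAt (fun s _ => hwd s)
      (hdc.intervalIntegrable _ _)]
    simp [hw]
  refine ⟨fun t => w t + h t, (hwp.add hh).congr (fun t ht => ?_) fun t _ => rfl⟩
  simp [ha, max_eq_right ht, mulVec_add]

/-- The states reachable from `0` are orthogonal to the kernel of the controllability Gramian. -/
theorem IsZeroTrajectory.mulVec_eq_zero [DecidableEq ν] {A P : Matrix ν ν ℝ} {B : Matrix ν ι ℝ}
    {u : ℝ → ι → ℝ} {x : ℝ → ν → ℝ} (hx : IsZeroTrajectory A B u x) (hPt : Pᵀ = P)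
    (hP : A * P + P * Aᵀ + B * Bᵀ = 0) {M : Matrix κ ν ℝ} (hM : M * P = 0) {t : ℝ} (ht : 0 ≤ t) :
    M *ᵥ x t = 0 := by
  -- `K` is a projection onto `ker P`. The Lyapunov equation puts `ker P` inside `ker Bᵀ` and makes
  -- it invariant under `Aᵀ`, so `Kᵀ x` obeys a homogeneous equation. The rows of `M` lie in `ker
  -- P`, whence `M = M Kᵀ`.
  obtain ⟨g, hg⟩ := LinearMap.exists_extend
    (LinearMap.id : LinearMap.ker P.mulVecLin →ₗ[ℝ] LinearMap.ker P.mulVecLin)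
  set K : Matrix ν ν ℝ := LinearMap.toMatrix' ((LinearMap.ker P.mulVecLin).subtype ∘ₗ g) with hK
  have hKv : ∀ v, K *ᵥ v = g v := fun v => by simp [hK, LinearMap.toMatrix'_mulVec]
  have hfix : ∀ v, P *ᵥ v = 0 → K *ᵥ v = v := fun v hv => by
    rw [hKv]
    exact congrArg Subtype.val (LinearMap.congr_fun hg ⟨v, hv⟩)
  have hPK : ∀ v, P *ᵥ (K *ᵥ v) = 0 := fun v => by rw [hKv]; exact (g v).2
  have hB : ∀ v, P *ᵥ v = 0 → Bᵀ *ᵥ v = 0 := fun v hv => by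
    have h1 : v ⬝ᵥ (A * P + P * Aᵀ + B * Bᵀ) *ᵥ v = 0 := by rw [hP]; simp
    have h2 : v ⬝ᵥ P *ᵥ (Aᵀ *ᵥ v) = 0 := by
      rw [dotProduct_mulVec, ← mulVec_transpose, hPt, hv, zero_dotProduct]
    have h3 : v ⬝ᵥ B *ᵥ (Bᵀ *ᵥ v) = (Bᵀ *ᵥ v) ⬝ᵥ (Bᵀ *ᵥ v) := by
      rw [dotProduct_mulVec, ← mulVec_transpose]
    simp only [add_mulVec, dotProduct_add, ← mulVec_mulVec, hv, mulVec_zero, h2, h3,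
      zero_add] at h1
    exact dotProduct_self_eq_zero.1 h1
  have hAt : ∀ v, P *ᵥ v = 0 → P *ᵥ (Aᵀ *ᵥ v) = 0 := fun v hv => by
    have h1 : (A * P + P * Aᵀ + B * Bᵀ) *ᵥ v = 0 := by rw [hP]; simp
    simpa only [add_mulVec, ← mulVec_mulVec, hv, hB v hv, mulVec_zero, zero_add, add_zero] using h1
  have hNB : Kᵀ * B = 0 := by
    rw [← transpose_inj, transpose_mul, transpose_transpose, transpose_zero]
    exact ext_of_mulVec_single fun i => by
      rw [← mulVec_mulVec, hB _ (hPK _), zero_mulVec]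
  have hNA : Kᵀ * A * Kᵀ = Kᵀ * A := by
    rw [← transpose_inj]
    simp only [transpose_mul, transpose_transpose]
    exact ext_of_mulVec_single fun i => by
      rw [← mulVec_mulVec, hfix]
      rw [← mulVec_mulVec]
      exact hAt _ (hPK _)
  have hMN : M * Kᵀ = M := by
    rw [← transpose_inj, transpose_mul, transpose_transpose]
    have hPM : P * Mᵀ = 0 := by rw [← hPt, ← transpose_mul, hM, transpose_zero]
    ext i j
    have := congrFun (hfix (fun k => M j k) (by
      ext k; exact congrFun (congrFun hPM k) j)) i
    exact this
  have hp : IsPrimitive (fun s => (Kᵀ * A) *ᵥ (Kᵀ *ᵥ x s)) (fun s => Kᵀ *ᵥ x s) := by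
    refine (IsPrimitive.mulVec hx Kᵀ).congr (fun s _ => ?_) fun _ _ => rfl
    rw [mulVec_mulVec, hNA, mulVec_add, mulVec_mulVec, mulVec_mulVec, hNB, zero_mulVec, add_zero]
  rw [← hMN, ← mulVec_mulVec, hp.eq_zero_of_linear ht, mulVec_zero]

end Solutions

/-! ### Algebra of square-root balancing -/

section Balancing

variable {n k r : ℕ} {ι o : Type*} [Fintype ι] [Fintype o]

/-- The Gramians, their factors and the singular value decomposition of square-root balancing. -/
structure IsBalancingData (A : Matrix (Fin n) (Fin n) ℝ) (B : Matrix (Fin n) ι ℝ)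
    (C : Matrix o (Fin n) ℝ) (P Q R L U Z : Matrix (Fin n) (Fin n) ℝ) (η : Fin n → ℝ) : Prop where
  ctr : A * P + P * Aᵀ + B * Bᵀ = 0
  obs : Aᵀ * Q + Q * A + Cᵀ * C = 0
  P_eq : P = R * Rᵀ
  Q_eq : Q = L * Lᵀ
  U_orth : Uᵀ * U = 1
  Z_orth : Zᵀ * Z = 1
  svd : Lᵀ * R = U * diagonal η * Zᵀ

/-- The projection matrix `R Z_k Σ_k^{-1/2}`. -/
noncomputable def balancingBasis (hk : k ≤ n) (R Z : Matrix (Fin n) (Fin n) ℝ) (η : Fin n → ℝ) :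
    Matrix (Fin n) (Fin k) ℝ :=
  R * leadingCols hk Z * diagonal (fun i : Fin k => (Real.sqrt (η (Fin.castLE hk i)))⁻¹)

theorem leadingCols_eq_mul (hk : k ≤ n) (M : Matrix (Fin n) (Fin n) ℝ) :
    leadingCols hk M = M * leadingCols hk 1 := by
  ext i j
  simp [leadingCols, mul_apply, one_apply]

theorem diagonal_mul_leadingCols_one (hk : k ≤ n) (η : Fin n → ℝ) :
    diagonal η * leadingCols hk 1
      = leadingCols hk 1 * diagonal (fun i : Fin k => η (Fin.castLE hk i)) := by
  ext i j
  rw [diagonal_mul, mul_diagonal]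
  by_cases h : i = Fin.castLE hk j <;> simp [leadingCols, one_apply, h]

theorem leadingCols_transpose_mul (hk : k ≤ n) {U : Matrix (Fin n) (Fin n) ℝ} (hU : Uᵀ * U = 1) :
    (leadingCols hk U)ᵀ * leadingCols hk U = 1 := by
  ext i j
  have := congrFun (congrFun hU (Fin.castLE hk i)) (Fin.castLE hk j)
  simpa [leadingCols, mul_apply, one_apply] using this

theorem transpose_mul_balancingBasis (hk : k ≤ n) {R L U Z : Matrix (Fin n) (Fin n) ℝ}
    {η : Fin n → ℝ} (hZ : Zᵀ * Z = 1) (hsvd : Lᵀ * R = U * diagonal η * Zᵀ) :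
    Lᵀ * balancingBasis hk R Z η = leadingCols hk U *
      (diagonal (fun i : Fin k => (Real.sqrt (η (Fin.castLE hk i)))⁻¹) *
        diagonal (fun i : Fin k => η (Fin.castLE hk i))) := by
  have e : Lᵀ * balancingBasis hk R Z η = U * (diagonal η * leadingCols hk 1) *
      diagonal (fun i : Fin k => (Real.sqrt (η (Fin.castLE hk i)))⁻¹) := by
    rw [balancingBasis, leadingCols_eq_mul hk Z]
    simp only [← Matrix.mul_assoc, hsvd]
    simp only [Matrix.mul_assoc U, Matrix.mul_assoc (diagonal η), hZ, Matrix.mul_one]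
  rw [e, diagonal_mul_leadingCols_one, leadingCols_eq_mul hk U]
  simp only [Matrix.mul_assoc, diagonal_mul_diagonal, mul_comm]

/-- This is `Q V = W Σ_k`. No positivity is needed, since `Σ_k^{-1/2} Σ_k` is never simplified. -/
theorem mul_transpose_mul_balancingBasis (hk : k ≤ n) {R L U Z : Matrix (Fin n) (Fin n) ℝ}
    {η : Fin n → ℝ} (hZ : Zᵀ * Z = 1) (hsvd : Lᵀ * R = U * diagonal η * Zᵀ) :
    L * Lᵀ * balancingBasis hk R Z η
      = balancingBasis hk L U η * diagonal (fun i : Fin k => η (Fin.castLE hk i)) := by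
  rw [Matrix.mul_assoc, transpose_mul_balancingBasis hk hZ hsvd, balancingBasis]
  simp only [Matrix.mul_assoc]

theorem balancingBasis_transpose_mul (hk : k ≤ n) {R L U Z : Matrix (Fin n) (Fin n) ℝ}
    {η : Fin n → ℝ} (hU : Uᵀ * U = 1) (hZ : Zᵀ * Z = 1) (hsvd : Lᵀ * R = U * diagonal η * Zᵀ)
    (hpos : ∀ i : Fin k, 0 < η (Fin.castLE hk i)) :
    (balancingBasis hk L U η)ᵀ * balancingBasis hk R Z η = 1 := by
  have e : (balancingBasis hk L U η)ᵀ =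
      diagonal (fun i : Fin k => (Real.sqrt (η (Fin.castLE hk i)))⁻¹) *
        ((leadingCols hk U)ᵀ * Lᵀ) := by
    rw [balancingBasis, transpose_mul, transpose_mul, diagonal_transpose]
  rw [e, Matrix.mul_assoc, Matrix.mul_assoc, transpose_mul_balancingBasis hk hZ hsvd,
    ← Matrix.mul_assoc (leadingCols hk U)ᵀ, leadingCols_transpose_mul hk hU, Matrix.one_mul,
    diagonal_mul_diagonal, diagonal_mul_diagonal, ← diagonal_one]
  congr 1
  ext i
  have h1 := Real.mul_self_sqrt (hpos i).le
  have h2 := (Real.sqrt_pos.2 (hpos i)).ne'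
  field_simp
  rw [sq, h1]

/-- Duality: exchanging `(R, Z)` with `(L, U)` yields each statement about `P` from the one about
`Q`. -/
theorem svd_swap {R L U Z : Matrix (Fin n) (Fin n) ℝ} {η : Fin n → ℝ}
    (hsvd : Lᵀ * R = U * diagonal η * Zᵀ) : Rᵀ * L = Z * diagonal η * Uᵀ := by
  have := congrArg transpose hsvd
  simpa [transpose_mul, Matrix.mul_assoc] using this

namespace IsBalancingData

variable {A P Q R L U Z : Matrix (Fin n) (Fin n) ℝ} {B : Matrix (Fin n) ι ℝ}
  {C : Matrix o (Fin n) ℝ} {η : Fin n → ℝ}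

theorem P_mul (h : IsBalancingData A B C P Q R L U Z η) (hk : k ≤ n) :
    P * balancingBasis hk L U η
      = balancingBasis hk R Z η * diagonal (fun i : Fin k => η (Fin.castLE hk i)) := by
  rw [h.P_eq, mul_transpose_mul_balancingBasis hk h.U_orth (svd_swap h.svd)]

theorem Q_mul (h : IsBalancingData A B C P Q R L U Z η) (hk : k ≤ n) :
    Q * balancingBasis hk R Z η
      = balancingBasis hk L U η * diagonal (fun i : Fin k => η (Fin.castLE hk i)) := by
  rw [h.Q_eq, mul_transpose_mul_balancingBasis hk h.Z_orth h.svd]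

theorem P_symm (h : IsBalancingData A B C P Q R L U Z η) : Pᵀ = P := by
  rw [h.P_eq, transpose_mul, transpose_transpose]

theorem Q_symm (h : IsBalancingData A B C P Q R L U Z η) : Qᵀ = Q := by
  rw [h.Q_eq, transpose_mul, transpose_transpose]

theorem Q_posSemidef (h : IsBalancingData A B C P Q R L U Z η) : Q.PosSemidef := by
  rw [h.Q_eq]
  simpa using posSemidef_self_mul_conjTranspose L

theorem transpose_mul_eq_one (h : IsBalancingData A B C P Q R L U Z η) (hk : k ≤ n)
    (hpos : ∀ i : Fin k, 0 < η (Fin.castLE hk i)) :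
    (balancingBasis hk L U η)ᵀ * balancingBasis hk R Z η = 1 :=
  balancingBasis_transpose_mul hk h.U_orth h.Z_orth h.svd hpos

/-- Compressing the Lyapunov equation by `W` and using `P W = V Σ_k` shows that `Σ_k` is a Gramian
of the truncated model, for every order `k`. -/
theorem reduced_ctr (h : IsBalancingData A B C P Q R L U Z η) (hk : k ≤ n) :
    ((balancingBasis hk L U η)ᵀ * A * balancingBasis hk R Z η) *
        diagonal (fun i : Fin k => η (Fin.castLE hk i)) +
      diagonal (fun i : Fin k => η (Fin.castLE hk i)) *
        ((balancingBasis hk L U η)ᵀ * A * balancingBasis hk R Z η)ᵀ +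
      ((balancingBasis hk L U η)ᵀ * B) * ((balancingBasis hk L U η)ᵀ * B)ᵀ = 0 := by
  have h1 := h.P_mul hk
  have h2 := congrArg transpose h1
  rw [transpose_mul, transpose_mul, h.P_symm, diagonal_transpose] at h2
  have h3 := congrArg (fun M => (balancingBasis hk L U η)ᵀ * M * balancingBasis hk L U η) h.ctr
  simp only [Matrix.mul_add, Matrix.add_mul, Matrix.mul_zero, Matrix.zero_mul] at h3
  rw [← h3]
  simp only [transpose_mul, transpose_transpose]
  congr 2
  · simp only [Matrix.mul_assoc, h1]
  · simp only [← Matrix.mul_assoc, h2]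
  · simp only [Matrix.mul_assoc]

theorem reduced_obs (h : IsBalancingData A B C P Q R L U Z η) (hk : k ≤ n) :
    ((balancingBasis hk L U η)ᵀ * A * balancingBasis hk R Z η)ᵀ *
        diagonal (fun i : Fin k => η (Fin.castLE hk i)) +
      diagonal (fun i : Fin k => η (Fin.castLE hk i)) *
        ((balancingBasis hk L U η)ᵀ * A * balancingBasis hk R Z η) +
      (C * balancingBasis hk R Z η)ᵀ * (C * balancingBasis hk R Z η) = 0 := by
  have h1 := h.Q_mul hk
  have h2 := congrArg transpose h1
  rw [transpose_mul, transpose_mul, h.Q_symm, diagonal_transpose] at h2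
  have h3 := congrArg (fun M => (balancingBasis hk R Z η)ᵀ * M * balancingBasis hk R Z η) h.obs
  simp only [Matrix.mul_add, Matrix.add_mul, Matrix.mul_zero, Matrix.zero_mul] at h3
  rw [← h3]
  simp only [transpose_mul, transpose_transpose]
  congr 2
  · simp only [Matrix.mul_assoc, h1]
  · simp only [← Matrix.mul_assoc, h2]
  · simp only [Matrix.mul_assoc]

/-- Both `P Q` and `P Q V Wᵀ = V Σ_k² Wᵀ` equal `R Z Σ Uᵀ Lᵀ`, because `Σ` has no nonzero entry
beyond `k`. Thus `Q (1 - V Wᵀ)` is invisible to reachable states. -/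
theorem P_mul_Q_mul_eq_zero (h : IsBalancingData A B C P Q R L U Z η) (hk : k ≤ n)
    (hpos : ∀ i : Fin k, 0 < η (Fin.castLE hk i)) (hzero : ∀ i : Fin n, k ≤ i → η i = 0) :
    P * (Q * (1 - balancingBasis hk R Z η * (balancingBasis hk L U η)ᵀ)) = 0 := by
  have e1 : leadingCols hk 1 * diagonal (fun i : Fin k => η (Fin.castLE hk i)) *
      (leadingCols hk (1 : Matrix (Fin n) (Fin n) ℝ))ᵀ = diagonal η := by
    ext i j
    rw [mul_apply]
    simp only [mul_diagonal, leadingCols, transpose_apply, submatrix_apply, id, one_apply]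
    by_cases hi : (i : ℕ) < k
    · rw [Finset.sum_eq_single ⟨i, hi⟩]
      · simp [diagonal_apply, Fin.ext_iff, eq_comm]
      · intro b _ hb
        have : i ≠ Fin.castLE hk b := fun hh => hb (by ext; simp [hh])
        simp [this]
      · simp
    · rw [Finset.sum_eq_zero]
      · simp [diagonal_apply, hzero i (not_lt.1 hi)]
      · intro b _
        have : i ≠ Fin.castLE hk b := fun hh => hi (by rw [hh]; exact b.2)
        simp [this]
  have e2 : diagonal (fun i : Fin k => (Real.sqrt (η (Fin.castLE hk i)))⁻¹) *
      (diagonal (fun i : Fin k => η (Fin.castLE hk i)) *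
      (diagonal (fun i : Fin k => η (Fin.castLE hk i)) *
      diagonal (fun i : Fin k => (Real.sqrt (η (Fin.castLE hk i)))⁻¹))) =
      diagonal (fun i : Fin k => η (Fin.castLE hk i)) := by
    simp only [diagonal_mul_diagonal]
    congr 1
    ext i
    have h1 := Real.mul_self_sqrt (hpos i).le
    have h2 := (Real.sqrt_pos.2 (hpos i)).ne'
    field_simp
    rw [sq, sq, h1]
  have e3 : P * Q = R * (Z * diagonal η * Uᵀ) * Lᵀ := by
    rw [h.P_eq, h.Q_eq, ← svd_swap h.svd]
    simp only [Matrix.mul_assoc]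
  have e4 : P * (Q * (balancingBasis hk R Z η * (balancingBasis hk L U η)ᵀ)) = P * Q := by
    rw [← Matrix.mul_assoc Q, h.Q_mul hk, Matrix.mul_assoc, ← Matrix.mul_assoc P, h.P_mul hk, e3,
      ← e1]
    have e5 : (balancingBasis hk L U η)ᵀ =
        diagonal (fun i : Fin k => (Real.sqrt (η (Fin.castLE hk i)))⁻¹) *
          ((leadingCols hk 1)ᵀ * Uᵀ * Lᵀ) := by
      rw [balancingBasis, leadingCols_eq_mul hk U]
      simp only [transpose_mul, diagonal_transpose, Matrix.mul_assoc]
    rw [e5, balancingBasis, leadingCols_eq_mul hk Z]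
    conv_rhs => rw [← e2]
    simp only [Matrix.mul_assoc]
  rw [Matrix.mul_sub, Matrix.mul_sub, Matrix.mul_one, e4, sub_self]

/-- Truncating the states with zero Hankel singular value does not change the output. -/
theorem integral_output_error_minimal_le (h : IsBalancingData A B C P Q R L U Z η) (hk : k ≤ n)
    (hpos : ∀ i : Fin k, 0 < η (Fin.castLE hk i)) (hzero : ∀ i : Fin n, k ≤ i → η i = 0)
    {u : ℝ → ι → ℝ} {x : ℝ → Fin n → ℝ} {v : ℝ → Fin k → ℝ} (hx : IsZeroTrajectory A B u x)
    (hv : IsZeroTrajectory ((balancingBasis hk L U η)ᵀ * A * balancingBasis hk R Z η)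
      ((balancingBasis hk L U η)ᵀ * B) u v)
    {T : ℝ} (hT : 0 ≤ T) (hu : IntervalIntegrable (fun t => u t ⬝ᵥ u t) volume 0 T) :
    ∫ t in (0 : ℝ)..T, (C *ᵥ x t - (C * balancingBasis hk R Z η) *ᵥ v t) ⬝ᵥ
      (C *ᵥ x t - (C * balancingBasis hk R Z η) *ᵥ v t) ≤ 0 := by
  have hEQ : (balancingBasis hk R Z η)ᵀ * Q *
      (1 - balancingBasis hk R Z η * (balancingBasis hk L U η)ᵀ) = 0 := by
    have h2 := congrArg transpose (h.Q_mul hk)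
    rw [transpose_mul, transpose_mul, h.Q_symm] at h2
    rw [h2, Matrix.mul_sub, Matrix.mul_one, Matrix.mul_assoc, ← Matrix.mul_assoc _ _ (_)ᵀ,
      h.transpose_mul_eq_one hk hpos, Matrix.one_mul, sub_self]
  -- With `σ = 0` and `S = 0` the cross condition reads `xᵀ Q (1 - V Wᵀ) = 0`, which holds for
  -- reachable `x`.
  have key := IsZeroTrajectory.integral_output_error_le (σ := 0) h.Q_posSemidef
    (S := 0) PosSemidef.zero h.obs (by simp) hEQ (by simp) hx hv (fun t ht => ?_) hT hu
  · simpa using key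
  · rw [← mulVec_transpose, hx.mulVec_eq_zero h.P_symm h.ctr _ ht]
    · simp
    · rw [← transpose_inj, transpose_mul, transpose_transpose, h.P_symm,
        h.P_mul_Q_mul_eq_zero hk hpos hzero, transpose_zero]

end IsBalancingData

end Balancing

/-! ### Removing one state from a balanced system -/

section OneStep

variable {k : ℕ} {ι o : Type*} [Fintype ι] [Fintype o]

/-- The embedding of the first `k` coordinates. -/
def castSuccEmbedding (k : ℕ) : Matrix (Fin (k + 1)) (Fin k) ℝ :=
  (1 : Matrix (Fin (k + 1)) (Fin (k + 1)) ℝ).submatrix id Fin.castSucc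

theorem one_sub_castSuccEmbedding_mul_transpose (k : ℕ) :
    1 - castSuccEmbedding k * (castSuccEmbedding k)ᵀ = diagonal (Pi.single (Fin.last k) 1) := by
  ext i j
  rw [Matrix.sub_apply, mul_apply]
  refine Fin.lastCases ?_ (fun i => ?_) i
  · simp [castSuccEmbedding, one_apply, diagonal_apply, (Fin.castSucc_lt_last _).ne']
  · rw [Finset.sum_eq_single i]
    · simp [castSuccEmbedding, one_apply, diagonal_apply, (Fin.castSucc_lt_last _).ne, eq_comm]
    · intro b _ hb
      simp [castSuccEmbedding, one_apply, Ne.symm hb]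
    · simp

theorem castSuccEmbedding_transpose_mul_diagonal_single (k : ℕ) :
    (castSuccEmbedding k)ᵀ * diagonal (Pi.single (Fin.last k) (1 : ℝ)) = 0 := by
  ext i j
  rw [mul_diagonal]
  by_cases hj : j = Fin.last k
  · subst hj
    simp [castSuccEmbedding, one_apply, (Fin.castSucc_lt_last _).ne']
  · simp [hj]

/-- Error bound for the truncation of a single state of a balanced system, on a finite horizon. -/
theorem integral_output_error_truncate_last_le {A : Matrix (Fin (k + 1)) (Fin (k + 1)) ℝ}
    {B : Matrix (Fin (k + 1)) ι ℝ} {C : Matrix o (Fin (k + 1)) ℝ} {s : Fin (k + 1) → ℝ}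
    (hs : ∀ i, 0 < s i) (hctr : A * diagonal s + diagonal s * Aᵀ + B * Bᵀ = 0)
    (hobs : Aᵀ * diagonal s + diagonal s * A + Cᵀ * C = 0)
    {u : ℝ → ι → ℝ} {x : ℝ → Fin (k + 1) → ℝ} {v : ℝ → Fin k → ℝ}
    (hx : IsZeroTrajectory A B u x)
    (hv : IsZeroTrajectory ((castSuccEmbedding k)ᵀ * A * castSuccEmbedding k)
      ((castSuccEmbedding k)ᵀ * B) u v)
    {T : ℝ} (hT : 0 ≤ T) (hu : IntervalIntegrable (fun t => u t ⬝ᵥ u t) volume 0 T) :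
    ∫ t in (0 : ℝ)..T, (C *ᵥ x t - (C * castSuccEmbedding k) *ᵥ v t) ⬝ᵥ
      (C *ᵥ x t - (C * castSuccEmbedding k) *ᵥ v t)
      ≤ (2 * s (Fin.last k)) ^ 2 * ∫ t in (0 : ℝ)..T, u t ⬝ᵥ u t := by
  have hinv1 : diagonal (fun i => (s i)⁻¹) * diagonal s = 1 := by
    rw [diagonal_mul_diagonal, ← diagonal_one]
    congr 1; ext i; exact inv_mul_cancel₀ (hs i).ne'
  have hinv2 : diagonal s * diagonal (fun i => (s i)⁻¹) = 1 := by
    rw [diagonal_mul_diagonal, ← diagonal_one]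
    congr 1; ext i; exact mul_inv_cancel₀ (hs i).ne'
  -- Multiplying the controllability equation by `Σ⁻¹` on both sides makes `S = Σ⁻¹` admissible.
  have hctr' : Aᵀ * diagonal (fun i => (s i)⁻¹) + diagonal (fun i => (s i)⁻¹) * A
      + diagonal (fun i => (s i)⁻¹) * B * Bᵀ * diagonal (fun i => (s i)⁻¹) = 0 := by
    have h3 := congrArg (fun M => diagonal (fun i => (s i)⁻¹) * M * diagonal (fun i => (s i)⁻¹))
      hctr
    simp only [Matrix.mul_add, Matrix.add_mul, Matrix.mul_zero, Matrix.zero_mul] at h3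
    rw [← h3]
    simp only [← Matrix.mul_assoc, hinv1, Matrix.one_mul]
    simp only [Matrix.mul_assoc, hinv2, Matrix.mul_one]
    rw [add_comm (Aᵀ * _)]
  have hE : ∀ d : Fin (k + 1) → ℝ, (castSuccEmbedding k)ᵀ * diagonal d *
      (1 - castSuccEmbedding k * (castSuccEmbedding k)ᵀ) = 0 := fun d => by
    rw [one_sub_castSuccEmbedding_mul_transpose, Matrix.mul_assoc,
      (commute_diagonal d _).eq, ← Matrix.mul_assoc,
      castSuccEmbedding_transpose_mul_diagonal_single, Matrix.zero_mul]
  have key := IsZeroTrajectory.integral_output_error_le (σ := s (Fin.last k))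
    (PosSemidef.diagonal fun i => (hs i).le)
    (PosSemidef.diagonal fun i => (inv_pos.2 (hs i)).le) hobs hctr' (hE _) (hE _) hx hv
    (fun t _ => ?_) hT hu
  · refine key.trans_eq ?_
    ring
  -- Only the last coordinate survives in the cross condition, where it says `σ = σ² · σ⁻¹`.
  · rw [← vecMul_smul, one_sub_castSuccEmbedding_mul_transpose, diagonal_mul_diagonal,
      diagonal_mul_diagonal, ← diagonal_smul]
    congr 2
    ext i
    by_cases hi : i = Fin.last k
    · subst hi
      have := (hs (Fin.last k)).ne'
      simp
      field_simp
    · simp [hi]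

end OneStep

/-! ### Summing the one-state errors -/

section Chain

variable {n k r : ℕ} {ι o : Type*} [Fintype ι] [Fintype o]

/-- The scaling acts column by column, so the bases are nested and consecutive reduced models differ
by a one-state truncation. -/
theorem balancingBasis_eq_mul_castSuccEmbedding (hk : k + 1 ≤ n) (R Z : Matrix (Fin n) (Fin n) ℝ)
    (η : Fin n → ℝ) :
    balancingBasis (k.le_succ.trans hk) R Z η = balancingBasis hk R Z η * castSuccEmbedding k := by
  ext i j
  have e : (balancingBasis hk R Z η * castSuccEmbedding k) i j
      = balancingBasis hk R Z η i j.castSucc := by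
    simp [castSuccEmbedding, mul_apply, one_apply]
  rw [e, balancingBasis, balancingBasis, mul_diagonal, mul_diagonal]
  rfl

/-- Minkowski's inequality for squared `L²` norms on `[0, T]`. -/
theorem integral_add_dotProduct_self_le {a b : ℝ → o → ℝ} {T s t K : ℝ} (hT : 0 ≤ T)
    (ha : ContinuousOn a (Set.uIcc 0 T)) (hb : ContinuousOn b (Set.uIcc 0 T))
    (hs : 0 ≤ s) (ht : 0 ≤ t) (hK : 0 ≤ K)
    (h1 : ∫ τ in (0 : ℝ)..T, a τ ⬝ᵥ a τ ≤ s ^ 2 * K)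
    (h2 : ∫ τ in (0 : ℝ)..T, b τ ⬝ᵥ b τ ≤ t ^ 2 * K) :
    ∫ τ in (0 : ℝ)..T, (a τ + b τ) ⬝ᵥ (a τ + b τ) ≤ (s + t) ^ 2 * K := by
  have ia := intervalIntegrable_dotProduct ha.intervalIntegrable ha
  have ib := intervalIntegrable_dotProduct hb.intervalIntegrable hb
  have iab : IntervalIntegrable (fun τ => (a τ + b τ) ⬝ᵥ (a τ + b τ)) volume 0 T :=
    intervalIntegrable_dotProduct (ha.add hb).intervalIntegrable (ha.add hb)
  -- Young's inequality with weights `t/s` and `s/t` needs positive `s` and `t`; the shift by `ε`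
  -- covers zero values and is then sent to `0`.
  have key : ∀ ε > 0, ∫ τ in (0 : ℝ)..T, (a τ + b τ) ⬝ᵥ (a τ + b τ)
      ≤ ((s + ε) + (t + ε)) ^ 2 * K := by
    intro ε hε
    have hs' : 0 < s + ε := by linarith
    have ht' : 0 < t + ε := by linarith
    have h1' : ∫ τ in (0 : ℝ)..T, a τ ⬝ᵥ a τ ≤ (s + ε) ^ 2 * K :=
      h1.trans (by gcongr; linarith)
    have h2' : ∫ τ in (0 : ℝ)..T, b τ ⬝ᵥ b τ ≤ (t + ε) ^ 2 * K :=
      h2.trans (by gcongr; linarith)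
    generalize s + ε = s' at *
    generalize t + ε = t' at *
    have m := intervalIntegral.integral_mono_on hT iab
      ((ia.const_mul (1 + t' / s')).add (ib.const_mul (1 + s' / t'))) (fun τ _ => by
        have q := dotProduct_self_nonneg_real (t' • a τ - s' • b τ)
        simp only [sub_dotProduct, dotProduct_sub, smul_dotProduct, dotProduct_smul, smul_eq_mul,
          dotProduct_comm (b τ) (a τ)] at q
        simp only [add_dotProduct, dotProduct_add, dotProduct_comm (b τ) (a τ)]
        have : (1 + t' / s') * (a τ ⬝ᵥ a τ) + (1 + s' / t') * (b τ ⬝ᵥ b τ)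
            - (a τ ⬝ᵥ a τ + a τ ⬝ᵥ b τ + (a τ ⬝ᵥ b τ + b τ ⬝ᵥ b τ))
            = (t' * (t' * (a τ ⬝ᵥ a τ)) - s' * (t' * (a τ ⬝ᵥ b τ))
              - (t' * (s' * (a τ ⬝ᵥ b τ)) - s' * (s' * (b τ ⬝ᵥ b τ)))) / (s' * t') := by
          field_simp
          ring
        have q' : 0 ≤ (t' * (t' * (a τ ⬝ᵥ a τ)) - s' * (t' * (a τ ⬝ᵥ b τ))
              - (t' * (s' * (a τ ⬝ᵥ b τ)) - s' * (s' * (b τ ⬝ᵥ b τ)))) / (s' * t') :=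
          div_nonneg (by linarith) (mul_pos hs' ht').le
        linarith)
    rw [intervalIntegral.integral_add (ia.const_mul _) (ib.const_mul _),
      intervalIntegral.integral_const_mul, intervalIntegral.integral_const_mul] at m
    refine m.trans ?_
    calc _ ≤ (1 + t' / s') * (s' ^ 2 * K) + (1 + s' / t') * (t' ^ 2 * K) := by
          gcongr
      _ = _ := by field_simp; ring
  have lim : Filter.Tendsto (fun ε : ℝ => ((s + ε) + (t + ε)) ^ 2 * K) (nhdsWithin 0 (Set.Ioi 0))
      (nhds ((s + t) ^ 2 * K)) := by
    have : Continuous fun ε : ℝ => ((s + ε) + (t + ε)) ^ 2 * K := by fun_prop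
    simpa using (this.tendsto 0).mono_left nhdsWithin_le_nhds
  exact ge_of_tendsto lim (eventually_nhdsWithin_of_forall fun ε hε => key ε hε)

theorem intervalIntegral_dotProduct_self_nonneg (u : ℝ → ι → ℝ) {T : ℝ} (hT : 0 ≤ T) :
    0 ≤ ∫ t in (0 : ℝ)..T, u t ⬝ᵥ u t :=
  intervalIntegral.integral_nonneg hT fun t _ => dotProduct_self_nonneg_real (u t)

namespace IsBalancingData

variable {A P Q R L U Z : Matrix (Fin n) (Fin n) ℝ} {B : Matrix (Fin n) ι ℝ}
  {C : Matrix o (Fin n) ℝ} {η : Fin n → ℝ}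

/-- Induction on `k` starting from `r`: each new model is driven by the same input, and its distance
to the previous one is at most `2 η` of the added state. -/
theorem exists_trajectory_integral_error_le (h : IsBalancingData A B C P Q R L U Z η)
    (hη : ∀ i, 0 ≤ η i) (hr : r ≤ n) {u : ℝ → ι → ℝ} {xr : ℝ → Fin r → ℝ}
    (hxr : IsZeroTrajectory ((balancingBasis hr L U η)ᵀ * A * balancingBasis hr R Z η)
      ((balancingBasis hr L U η)ᵀ * B) u xr)
    (hu : ∀ t, 0 ≤ t → IntervalIntegrable u volume 0 t)
    (hu2 : ∀ t, 0 ≤ t → IntervalIntegrable (fun t => u t ⬝ᵥ u t) volume 0 t)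
    (hrk : r ≤ k) (hk : k ≤ n) (hpos : ∀ i : Fin k, 0 < η (Fin.castLE hk i)) :
    ∃ v, IsZeroTrajectory ((balancingBasis hk L U η)ᵀ * A * balancingBasis hk R Z η)
      ((balancingBasis hk L U η)ᵀ * B) u v ∧ ∀ T, 0 ≤ T →
        ∫ t in (0 : ℝ)..T,
          ((C * balancingBasis hk R Z η) *ᵥ v t - (C * balancingBasis hr R Z η) *ᵥ xr t) ⬝ᵥ
          ((C * balancingBasis hk R Z η) *ᵥ v t - (C * balancingBasis hr R Z η) *ᵥ xr t)
        ≤ (2 * ∑ i ∈ Finset.univ.filter (fun i : Fin n => r ≤ (i : ℕ) ∧ (i : ℕ) < k), η i) ^ 2 *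
          ∫ t in (0 : ℝ)..T, u t ⬝ᵥ u t := by
  induction k, hrk using Nat.le_induction with
  | base =>
    refine ⟨xr, hxr, fun T hT => ?_⟩
    simpa using mul_nonneg (sq_nonneg _) (intervalIntegral_dotProduct_self_nonneg u hT)
  | succ k hrk ih =>
    obtain ⟨v, hv, hvb⟩ := ih (k.le_succ.trans hk) (fun i => hpos i.castSucc)
    obtain ⟨w, hw⟩ := exists_isZeroTrajectory
      ((balancingBasis hk L U η)ᵀ * A * balancingBasis hk R Z η)
      ((balancingBasis hk L U η)ᵀ * B) hu
    refine ⟨w, hw, fun T hT => ?_⟩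
    have hv' : IsZeroTrajectory ((castSuccEmbedding k)ᵀ *
        ((balancingBasis hk L U η)ᵀ * A * balancingBasis hk R Z η) * castSuccEmbedding k)
        ((castSuccEmbedding k)ᵀ * ((balancingBasis hk L U η)ᵀ * B)) u v := by
      simpa only [balancingBasis_eq_mul_castSuccEmbedding hk, transpose_mul,
        Matrix.mul_assoc] using hv
    have step := integral_output_error_truncate_last_le hpos (h.reduced_ctr hk) (h.reduced_obs hk)
      hw hv' hT (hu2 T hT)
    rw [Matrix.mul_assoc C, ← balancingBasis_eq_mul_castSuccEmbedding hk] at step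
    have cw := (IsPrimitive.mulVec hw (C * balancingBasis hk R Z η)).continuousOn_uIcc hT
    have cv := (IsPrimitive.mulVec hv
      (C * balancingBasis (k.le_succ.trans hk) R Z η)).continuousOn_uIcc hT
    have cr := (IsPrimitive.mulVec hxr (C * balancingBasis hr R Z η)).continuousOn_uIcc hT
    have key := integral_add_dotProduct_self_le hT (cw.sub cv) (cv.sub cr)
      (mul_nonneg zero_le_two (hpos (Fin.last k)).le)
      (mul_nonneg zero_le_two (Finset.sum_nonneg fun i _ => hη i))
      (intervalIntegral_dotProduct_self_nonneg u hT) step (hvb T hT)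
    simp only [Pi.sub_apply, sub_add_sub_cancel, ← mul_add] at key
    have hsum : ∑ i ∈ Finset.univ.filter (fun i : Fin n => r ≤ (i : ℕ) ∧ (i : ℕ) < k + 1), η i
        = η (Fin.castLE hk (Fin.last k)) +
          ∑ i ∈ Finset.univ.filter (fun i : Fin n => r ≤ (i : ℕ) ∧ (i : ℕ) < k), η i := by
      rw [← Finset.sum_insert (by simp)]
      congr 1
      ext i
      simp only [Finset.mem_filter, Finset.mem_univ, true_and, Finset.mem_insert, Fin.ext_iff,
        Fin.val_castLE, Fin.val_last]
      omega
    rw [hsum]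
    exact key

/-- Error bound of balanced truncation on a finite horizon, with zero initial states. -/
theorem integral_output_error_le (h : IsBalancingData A B C P Q R L U Z η)
    (hanti : Antitone η) (hη : ∀ i, 0 ≤ η i) (hr : r ≤ n)
    (hpos : ∀ i : Fin r, 0 < η (Fin.castLE hr i))
    {u : ℝ → ι → ℝ} {x : ℝ → Fin n → ℝ} {xr : ℝ → Fin r → ℝ}
    (hx : IsZeroTrajectory A B u x)
    (hxr : IsZeroTrajectory ((balancingBasis hr L U η)ᵀ * A * balancingBasis hr R Z η)
      ((balancingBasis hr L U η)ᵀ * B) u xr)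
    (hu : ∀ t, 0 ≤ t → IntervalIntegrable u volume 0 t)
    (hu2 : ∀ t, 0 ≤ t → IntervalIntegrable (fun t => u t ⬝ᵥ u t) volume 0 t)
    {T : ℝ} (hT : 0 ≤ T) :
    ∫ t in (0 : ℝ)..T,
      (C *ᵥ x t - (C * balancingBasis hr R Z η) *ᵥ xr t) ⬝ᵥ
      (C *ᵥ x t - (C * balancingBasis hr R Z η) *ᵥ xr t)
    ≤ (2 * ∑ i ∈ Finset.univ.filter (fun i : Fin n => r ≤ (i : ℕ)), η i) ^ 2 *
      ∫ t in (0 : ℝ)..T, u t ⬝ᵥ u t := by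
  classical
  have hex : ∃ k : ℕ, ∀ i : Fin n, k ≤ i → η i = 0 :=
    ⟨n, fun i hi => absurd i.2 (not_lt.2 hi)⟩
  -- By monotonicity this `k` is the number of nonzero singular values, that is, the order at which
  -- truncation stops being free.
  obtain ⟨k, hzero, hmin⟩ : ∃ k : ℕ, (∀ i : Fin n, k ≤ i → η i = 0) ∧
      ∀ j < k, ¬ ∀ i : Fin n, j ≤ i → η i = 0 :=
    ⟨Nat.find hex, Nat.find_spec hex, fun j hj => Nat.find_min hex hj⟩
  have hkn : k ≤ n := by
    by_contra hlt
    exact hmin n (not_le.1 hlt) fun i hi => absurd i.2 (not_lt.2 hi)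
  have hkpos : ∀ i : Fin k, 0 < η (Fin.castLE hkn i) := fun i => by
    have := hmin i i.2
    push Not at this
    obtain ⟨j, hij, hj⟩ := this
    exact ((hη j).lt_of_ne' hj).trans_le (hanti (Fin.le_def.2 hij))
  have hrk : r ≤ k := by
    by_contra hlt
    exact (hpos ⟨k, not_le.1 hlt⟩).ne' (hzero _ le_rfl)
  obtain ⟨v, hv, hvb⟩ := h.exists_trajectory_integral_error_le hη hr hxr hu hu2 hrk hkn hkpos
  have step := h.integral_output_error_minimal_le hkn hkpos hzero hx hv hT (hu2 T hT)
  have cx := (IsPrimitive.mulVec hx C).continuousOn_uIcc hT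
  have cv := (IsPrimitive.mulVec hv (C * balancingBasis hkn R Z η)).continuousOn_uIcc hT
  have cr := (IsPrimitive.mulVec hxr (C * balancingBasis hr R Z η)).continuousOn_uIcc hT
  have key := integral_add_dotProduct_self_le (s := 0) hT (cx.sub cv) (cv.sub cr) le_rfl
    (mul_nonneg zero_le_two (Finset.sum_nonneg fun i _ => hη i))
    (intervalIntegral_dotProduct_self_nonneg u hT) (by simpa using step) (hvb T hT)
  simp only [Pi.sub_apply, sub_add_sub_cancel, zero_add] at key
  refine key.trans_eq ?_
  congr 3
  refine Finset.sum_subset (fun i hi => ?_) fun i hi hi' => hzero i ?_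
  · simp only [Finset.mem_filter, Finset.mem_univ, true_and] at hi ⊢
    exact hi.1
  · simp only [Finset.mem_filter, Finset.mem_univ, true_and, not_and, not_lt] at hi hi'
    exact hi' hi

end IsBalancingData

end Chain

/-! ### Passage to complex matrices -/

section Complexification

variable {μ ν ξ : Type*}

/-- The complexification of a real matrix. -/
def complexify (M : Matrix μ ν ℝ) : Matrix μ ν ℂ := M.map Complex.ofReal

theorem complexify_mul [Fintype ν] (M : Matrix μ ν ℝ) (N : Matrix ν ξ ℝ) :
    complexify (M * N) = complexify M * complexify N :=
  Matrix.map_mul (f := Complex.ofRealHom)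

theorem complexify_add (M N : Matrix μ ν ℝ) :
    complexify (M + N) = complexify M + complexify N :=
  Matrix.map_add Complex.ofReal Complex.ofReal_add M N

theorem complexify_zero : complexify (0 : Matrix μ ν ℝ) = 0 :=
  Matrix.map_zero Complex.ofReal Complex.ofReal_zero

theorem complexify_one [DecidableEq ν] : complexify (1 : Matrix ν ν ℝ) = 1 :=
  Matrix.map_one Complex.ofReal Complex.ofReal_zero Complex.ofReal_one

theorem complexify_diagonal [DecidableEq ν] (d : ν → ℝ) :
    complexify (diagonal d) = diagonal fun i => (d i : ℂ) :=
  Matrix.diagonal_map Complex.ofReal_zero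

theorem complexify_transpose (M : Matrix μ ν ℝ) : complexify Mᵀ = (complexify M)ᴴ := by
  ext i j
  simp [complexify]

end Complexification

/-! ### Lyapunov equations and eigenvectors -/

section Stability

open scoped ComplexOrder

variable {ν o : Type*} [Fintype ν] [Fintype o]

theorem lyapunov_eigenvector {a S : Matrix ν ν ℂ} {c : Matrix o ν ℂ}
    (h : aᴴ * S + S * a + cᴴ * c = 0) {v : ν → ℂ} {l : ℂ} (hv : a *ᵥ v = l • v) :
    ((2 * l.re : ℝ) : ℂ) * (star v ⬝ᵥ S *ᵥ v) + star (c *ᵥ v) ⬝ᵥ (c *ᵥ v) = 0 := by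
  have h1 : star v ⬝ᵥ (aᴴ * S + S * a + cᴴ * c) *ᵥ v = 0 := by rw [h]; simp
  have h2 : star v ⬝ᵥ aᴴ *ᵥ (S *ᵥ v) = star l * (star v ⬝ᵥ S *ᵥ v) := by
    rw [dotProduct_mulVec, ← star_mulVec, hv, star_smul, smul_dotProduct, smul_eq_mul]
  have h3 : star v ⬝ᵥ cᴴ *ᵥ (c *ᵥ v) = star (c *ᵥ v) ⬝ᵥ (c *ᵥ v) := by
    rw [dotProduct_mulVec, ← star_mulVec]
  simp only [add_mulVec, dotProduct_add, ← mulVec_mulVec, h2, h3, hv, mulVec_smul,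
    dotProduct_smul, smul_eq_mul] at h1
  have h4 : ((2 * l.re : ℝ) : ℂ) = star l + l := by
    rw [add_comm]
    exact (Complex.add_conj l).symm
  rw [h4, add_mul]
  exact h1

/-- On the imaginary axis the quadratic form of the equation reduces to `|cv|² = 0`; applying the
equation to `v` then leaves an eigenvector relation for `aᴴ`. Applying this to `a` and then to `aᴴ`
returns to the same eigenspace. -/
theorem lyapunov_eigenvector_of_re_eq_zero {a S : Matrix ν ν ℂ} {c : Matrix o ν ℂ}
    (h : aᴴ * S + S * a + cᴴ * c = 0) {v : ν → ℂ} {l : ℂ} (hv : a *ᵥ v = l • v)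
    (hl : l.re = 0) : c *ᵥ v = 0 ∧ aᴴ *ᵥ (S *ᵥ v) = (-l) • (S *ᵥ v) := by
  have h1 := lyapunov_eigenvector h hv
  rw [hl] at h1
  have h2 : c *ᵥ v = 0 := by
    refine dotProduct_star_self_eq_zero.1 ?_
    rw [dotProduct_comm]
    simpa using h1
  refine ⟨h2, ?_⟩
  have h3 : (aᴴ * S + S * a + cᴴ * c) *ᵥ v = 0 := by rw [h]; simp
  simp only [add_mulVec, ← mulVec_mulVec, h2, hv, mulVec_zero, add_zero, mulVec_smul] at h3
  rw [neg_smul]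
  exact eq_neg_of_add_eq_zero_left h3

theorem lyapunov_re_nonpos {a S : Matrix ν ν ℂ} {c : Matrix o ν ℂ} (hS : S.PosDef)
    (h : aᴴ * S + S * a + cᴴ * c = 0) {v : ν → ℂ} {l : ℂ} (hv : a *ᵥ v = l • v) (hv0 : v ≠ 0) :
    l.re ≤ 0 := by
  have h1 := congrArg Complex.re (lyapunov_eigenvector h hv)
  have h2 : 0 < (star v ⬝ᵥ S *ᵥ v).re := (Complex.lt_def.1 (hS.dotProduct_mulVec_pos hv0)).1
  have h3 : 0 ≤ (star (c *ᵥ v) ⬝ᵥ (c *ᵥ v)).re :=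
    (Complex.le_def.1 (dotProduct_star_self_nonneg (c *ᵥ v))).1
  rw [Complex.add_re, Complex.re_ofReal_mul, Complex.zero_re] at h1
  by_contra hl
  have := mul_pos (not_le.1 hl) h2
  linarith

/-- An eigenspace that is invariant under a diagonal matrix contains an
eigenvector of that matrix, whose eigenvalue is one of the diagonal entries. -/
theorem exists_common_eigenvector [DecidableEq ν] {a : Matrix ν ν ℂ} {d : ν → ℂ} {l : ℂ}
    (hinv : ∀ v, a *ᵥ v = l • v → a *ᵥ (diagonal d *ᵥ v) = l • (diagonal d *ᵥ v))
    {v₀ : ν → ℂ} (hv₀ : a *ᵥ v₀ = l • v₀) (hne : v₀ ≠ 0) :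
    ∃ v i, v ≠ 0 ∧ a *ᵥ v = l • v ∧ diagonal d *ᵥ v = d i • v := by
  set E := Module.End.eigenspace (Matrix.toLin' a) l with hE
  have memE : ∀ v, v ∈ E ↔ a *ᵥ v = l • v := fun v => by
    rw [hE, Module.End.mem_eigenspace_iff, Matrix.toLin'_apply]
  have hmap : ∀ v ∈ E, Matrix.toLin' (diagonal d) v ∈ E := fun v hv => by
    rw [Matrix.toLin'_apply, memE]
    exact hinv v ((memE v).1 hv)
  have : Nontrivial E := ⟨⟨⟨v₀, (memE v₀).2 hv₀⟩, 0, fun hh => hne (congrArg Subtype.val hh)⟩⟩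
  obtain ⟨m, hm⟩ := Module.End.exists_eigenvalue ((Matrix.toLin' (diagonal d)).restrict hmap)
  obtain ⟨v, hv⟩ := hm.exists_hasEigenvector
  have hv1 : diagonal d *ᵥ (v : ν → ℂ) = m • (v : ν → ℂ) := by
    have := congrArg Subtype.val hv.apply_eq_smul
    simpa [Matrix.toLin'_apply] using this
  have hv0 : (v : ν → ℂ) ≠ 0 := fun hh => hv.2 (Subtype.ext hh)
  obtain ⟨i, hi⟩ := Function.ne_iff.1 hv0
  have hmi : d i = m := by
    have := congrFun hv1 i
    rw [mulVec_diagonal, Pi.smul_apply, smul_eq_mul] at this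
    exact mul_right_cancel₀ hi this
  exact ⟨v, i, hv0, (memE _).1 v.2, by rw [hmi, hv1]⟩

end Stability

/-! ### Stability of the truncated model -/

section BalancedStability

open scoped ComplexOrder

variable {n r : ℕ} {ι o : Type*} [Fintype ι] [Fintype o]
  {A P Q R L U Z : Matrix (Fin n) (Fin n) ℝ} {B : Matrix (Fin n) ι ℝ}
  {C : Matrix o (Fin n) ℝ} {η : Fin n → ℝ}

/-- The eigenspace of `P Q` to `η i ^ 2`, `i < r`, meets the kernel of `Wᵀ` only in `0`. -/
theorem IsBalancingData.eq_zero_of_eigenvector (h : IsBalancingData A B C P Q R L U Z η)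
    (hη : ∀ i, 0 ≤ η i) (hr : r ≤ n) (hpos : ∀ i : Fin r, 0 < η (Fin.castLE hr i))
    (hgap : ∀ (i : Fin r) (j : Fin n), r ≤ (j : ℕ) → η j < η (Fin.castLE hr i))
    (i : Fin r) {d : Fin n → ℂ}
    (hd : complexify P *ᵥ (complexify Q *ᵥ d) = ((η (Fin.castLE hr i) ^ 2 : ℝ) : ℂ) • d)
    (hWd : (complexify (balancingBasis hr L U η))ᴴ *ᵥ d = 0) : d = 0 := by
  -- In the coordinates `g` the operator `P Q` acts as `Σ²`. The first `r` entries vanish by `Wᵀ d =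
  -- 0`, the others by the gap. As `P Q d` factors through `g`, a nonzero eigenvalue forces `d = 0`.
  set g := (complexify U)ᴴ *ᵥ ((complexify L)ᴴ *ᵥ d) with hg
  have hPQ : complexify P *ᵥ (complexify Q *ᵥ d) =
      complexify (R * Z * diagonal η) *ᵥ g := by
    have e : P * Q = R * Z * diagonal η * (Uᵀ * Lᵀ) := by
      have := svd_swap h.svd
      rw [h.P_eq, h.Q_eq, Matrix.mul_assoc R, ← Matrix.mul_assoc Rᵀ, this]
      simp only [Matrix.mul_assoc]
    rw [mulVec_mulVec, ← complexify_mul, e, complexify_mul, complexify_mul Uᵀ,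
      complexify_transpose, complexify_transpose, hg]
    simp only [mulVec_mulVec, Matrix.mul_assoc]
  have hg2 : complexify (diagonal η * diagonal η) *ᵥ g
      = ((η (Fin.castLE hr i) ^ 2 : ℝ) : ℂ) • g := by
    have e : Uᵀ * Lᵀ * (R * Z * diagonal η) = diagonal η * diagonal η := by
      rw [Matrix.mul_assoc, Matrix.mul_assoc R, ← Matrix.mul_assoc Lᵀ, h.svd]
      simp only [← Matrix.mul_assoc, h.U_orth, Matrix.one_mul]
      rw [Matrix.mul_assoc _ Zᵀ Z, h.Z_orth, Matrix.mul_one]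
    have := congrArg (fun w => (complexify U)ᴴ *ᵥ ((complexify L)ᴴ *ᵥ w)) (hPQ.symm.trans hd)
    simp only [mulVec_smul, ← hg] at this
    rw [← this, ← e, ← complexify_transpose, ← complexify_transpose]
    simp only [mulVec_mulVec, complexify_mul, Matrix.mul_assoc]
  have hg0 : g = 0 := by
    ext j
    rw [Pi.zero_apply]
    by_cases hj : (j : ℕ) < r
    · have h1 := congrFun hWd ⟨j, hj⟩
      have e : (balancingBasis hr L U η)ᵀ =
          diagonal (fun i : Fin r => (Real.sqrt (η (Fin.castLE hr i)))⁻¹) *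
            ((leadingCols hr 1)ᵀ * (Uᵀ * Lᵀ)) := by
        rw [balancingBasis, leadingCols_eq_mul hr U]
        simp only [transpose_mul, diagonal_transpose, Matrix.mul_assoc]
      rw [← complexify_transpose, e, complexify_mul, complexify_mul, complexify_mul Uᵀ,
        complexify_diagonal, complexify_transpose U, complexify_transpose L, ← mulVec_mulVec,
        ← mulVec_mulVec, ← mulVec_mulVec, ← hg, mulVec_diagonal, Pi.zero_apply] at h1
      have h2 : (complexify (leadingCols hr (1 : Matrix (Fin n) (Fin n) ℝ))ᵀ *ᵥ g) ⟨j, hj⟩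
          = g j := by
        have : Fin.castLE hr ⟨j, hj⟩ = j := rfl
        simp only [mulVec, dotProduct, complexify, leadingCols, Matrix.map_apply, transpose_apply,
          submatrix_apply, id, this, one_apply]
        rw [Finset.sum_eq_single j]
        · simp
        · intro b _ hb
          simp [hb]
        · simp
      rw [h2] at h1
      refine (mul_eq_zero.1 h1).resolve_left ?_
      have := (Real.sqrt_pos.2 (hpos ⟨j, hj⟩)).ne'
      exact_mod_cast inv_ne_zero this
    · have h1 := congrFun hg2 j
      rw [diagonal_mul_diagonal, complexify_diagonal, mulVec_diagonal, Pi.smul_apply,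
        smul_eq_mul, ← sub_eq_zero, ← sub_mul] at h1
      refine (mul_eq_zero.1 h1).resolve_left ?_
      have h2 : η j * η j - η (Fin.castLE hr i) ^ 2 ≠ 0 := by
        have := hgap i j (not_lt.1 hj)
        have h0 := hη j
        nlinarith
      exact_mod_cast h2
  rw [hg0, mulVec_zero] at hPQ
  rw [hPQ] at hd
  have : ((η (Fin.castLE hr i) ^ 2 : ℝ) : ℂ) ≠ 0 := by
    exact_mod_cast (pow_pos (hpos i) 2).ne'
  exact (smul_eq_zero.1 hd.symm).resolve_left this

/-- Balanced truncation at a gap of the Hankel singular values preserves stability. -/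
theorem IsBalancingData.isAsymptoticallyStable_reduced
    (h : IsBalancingData A B C P Q R L U Z η) (hA : IsAsymptoticallyStable A)
    (hη : ∀ i, 0 ≤ η i) (hr : r ≤ n) (hpos : ∀ i : Fin r, 0 < η (Fin.castLE hr i))
    (hgap : ∀ (i : Fin r) (j : Fin n), r ≤ (j : ℕ) → η j < η (Fin.castLE hr i)) :
    IsAsymptoticallyStable ((balancingBasis hr L U η)ᵀ * A * balancingBasis hr R Z η) := by
  intro l hl
  set V := balancingBasis hr R Z η with hV
  set W := balancingBasis hr L U η with hW
  set s : Fin r → ℝ := fun i => η (Fin.castLE hr i) with hs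
  set a := complexify (Wᵀ * A * V) with ha
  have hctr : a * complexify (diagonal s) + complexify (diagonal s) * aᴴ
      + complexify (Wᵀ * B) * (complexify (Wᵀ * B))ᴴ = 0 := by
    simpa only [complexify_add, complexify_mul, complexify_zero, complexify_transpose, ha]
      using congrArg complexify (h.reduced_ctr hr)
  have hobs : aᴴ * complexify (diagonal s) + complexify (diagonal s) * a
      + (complexify (C * V))ᴴ * complexify (C * V) = 0 := by
    simpa only [complexify_add, complexify_mul, complexify_zero, complexify_transpose, ha]
      using congrArg complexify (h.reduced_obs hr)
  have hctr' : aᴴᴴ * complexify (diagonal s) + complexify (diagonal s) * aᴴ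
      + (complexify (Wᵀ * B))ᴴᴴ * (complexify (Wᵀ * B))ᴴ = 0 := by
    rw [conjTranspose_conjTranspose, conjTranspose_conjTranspose]
    exact hctr
  have hpd : (complexify (diagonal s)).PosDef := by
    rw [complexify_diagonal]
    refine PosDef.diagonal fun i => ?_
    exact_mod_cast hpos i
  obtain ⟨v₀, hv₀⟩ := hl.exists_hasEigenvector
  have hv₀' : a *ᵥ v₀ = l • v₀ := by
    have := hv₀.apply_eq_smul
    rwa [Matrix.toLin'_apply] at this
  refine (lyapunov_re_nonpos hpd hobs hv₀' hv₀.2).lt_of_ne fun hre => ?_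
  have hre' : (-l).re = 0 := by simp [hre]
  -- The observability equation sends `v` to an eigenvector relation for `aᴴ` at `-l`, the
  -- controllability equation sends it back to `a` at `l`: the eigenspace is invariant under `Σ_r²`.
  have chain : ∀ v, a *ᵥ v = l • v →
      complexify (C * V) *ᵥ v = 0 ∧
      (complexify (Wᵀ * B))ᴴ *ᵥ (complexify (diagonal s) *ᵥ v) = 0 ∧
      a *ᵥ (complexify (diagonal s) *ᵥ (complexify (diagonal s) *ᵥ v))
        = l • (complexify (diagonal s) *ᵥ (complexify (diagonal s) *ᵥ v)) := fun v hv => by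
    obtain ⟨h1, h2⟩ := lyapunov_eigenvector_of_re_eq_zero hobs hv hre
    obtain ⟨h3, h4⟩ := lyapunov_eigenvector_of_re_eq_zero hctr' h2 hre'
    rw [conjTranspose_conjTranspose, neg_neg] at h4
    exact ⟨h1, h3, h4⟩
  have hss : ∀ v, complexify (diagonal s) *ᵥ (complexify (diagonal s) *ᵥ v)
      = diagonal (fun i => ((s i ^ 2 : ℝ) : ℂ)) *ᵥ v := fun v => by
    rw [mulVec_mulVec, ← complexify_mul, diagonal_mul_diagonal, complexify_diagonal]
    simp only [sq]
  obtain ⟨v, i, hv0, hv, hvi⟩ := exists_common_eigenvector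
    (d := fun i => ((s i ^ 2 : ℝ) : ℂ)) (fun v hv => by
      have := (chain v hv).2.2
      rwa [hss] at this) hv₀' hv₀.2
  obtain ⟨hC, hB, -⟩ := chain v hv
  have hWV : (complexify W)ᴴ * complexify V = 1 := by
    rw [← complexify_transpose, ← complexify_mul, h.transpose_mul_eq_one hr hpos, complexify_one]
  have hQV : ∀ w, complexify Q *ᵥ (complexify V *ᵥ w)
      = complexify W *ᵥ (complexify (diagonal s) *ᵥ w) := fun w => by
    rw [mulVec_mulVec, mulVec_mulVec, ← complexify_mul, ← complexify_mul, h.Q_mul hr]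
  have hPW : ∀ w, complexify P *ᵥ (complexify W *ᵥ w)
      = complexify V *ᵥ (complexify (diagonal s) *ᵥ w) := fun w => by
    rw [mulVec_mulVec, mulVec_mulVec, ← complexify_mul, ← complexify_mul, h.P_mul hr]
  have e1 : (complexify A)ᴴ *ᵥ (complexify W *ᵥ (complexify (diagonal s) *ᵥ v))
      + complexify Q *ᵥ (complexify A *ᵥ (complexify V *ᵥ v)) = 0 := by
    have := congrArg (fun M => complexify M *ᵥ (complexify V *ᵥ v)) h.obs
    simp only [complexify_add, complexify_mul, complexify_zero, complexify_transpose, add_mulVec,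
      ← mulVec_mulVec, zero_mulVec] at this
    rw [complexify_mul, ← mulVec_mulVec] at hC
    rwa [hC, mulVec_zero, add_zero, hQV] at this
  have e2 : complexify A *ᵥ (complexify V *ᵥ
        (complexify (diagonal s) *ᵥ (complexify (diagonal s) *ᵥ v)))
      + complexify P *ᵥ ((complexify A)ᴴ *ᵥ
        (complexify W *ᵥ (complexify (diagonal s) *ᵥ v))) = 0 := by
    have := congrArg (fun M => complexify M *ᵥ
      (complexify W *ᵥ (complexify (diagonal s) *ᵥ v))) h.ctr
    simp only [complexify_add, complexify_mul, complexify_zero, complexify_transpose, add_mulVec,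
      ← mulVec_mulVec, zero_mulVec] at this
    rw [← complexify_transpose, transpose_mul, transpose_transpose, complexify_mul,
      complexify_transpose, ← mulVec_mulVec] at hB
    rwa [hB, mulVec_zero, add_zero, hPW] at this
  rw [eq_neg_of_add_eq_zero_left e1, mulVec_neg, hss, hvi, mulVec_smul, mulVec_smul,
    ← sub_eq_add_neg, sub_eq_zero] at e2
  -- `d` measures the failure of `V v` to be an eigenvector of `A`. The full Lyapunov equations give
  -- `P Q d = η_i² d`, and `Wᵀ V = 1` gives `Wᵀ d = 0`.
  set d := complexify A *ᵥ (complexify V *ᵥ v) - l • (complexify V *ᵥ v) with hd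
  have hd0 : d = 0 := by
    refine h.eq_zero_of_eigenvector hη hr hpos hgap i ?_ ?_
    · rw [hd, mulVec_sub, mulVec_sub, ← e2, mulVec_smul, mulVec_smul, hQV, hPW, hss, hvi,
        mulVec_smul, smul_sub, smul_comm l]
    · rw [← hW, hd, mulVec_sub, mulVec_smul, mulVec_mulVec v (complexify W)ᴴ, hWV, one_mulVec,
        ← complexify_transpose, mulVec_mulVec, mulVec_mulVec, ← complexify_mul, ← complexify_mul,
        ← ha, hv, sub_self]
  have hVv : complexify V *ᵥ v ≠ 0 := fun h0 => hv0 <| by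
    rw [← one_mulVec v, ← hWV, ← mulVec_mulVec, h0, mulVec_zero]
  have := hA l (Module.End.hasEigenvalue_of_hasEigenvector
    (x := complexify V *ᵥ v) ⟨Module.End.mem_eigenspace_iff.2 (by
      rw [Matrix.toLin'_apply]
      exact sub_eq_zero.1 hd0), hVv⟩)
  exact this.ne hre

end BalancedStability

/-! ### Infinite horizon and the shifted input -/

section Infinite

theorem normL2_sq {k : ℕ} (g : ℝ → (Fin k → ℝ)) :
    normL2 g ^ 2 = ∫ t in Set.Ici (0 : ℝ), g t ⬝ᵥ g t :=
  Real.sq_sqrt (integral_nonneg fun t => dotProduct_self_nonneg_real (g t))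

theorem memL2_and_normL2_le_of_forall_integral_le {k : ℕ} {e : ℝ → (Fin k → ℝ)} {c : ℝ}
    (hc : 0 ≤ c) (he : ContinuousOn e (Set.Ici 0))
    (hb : ∀ T, 0 ≤ T → ∫ t in (0 : ℝ)..T, e t ⬝ᵥ e t ≤ c ^ 2) :
    MemL2 e ∧ normL2 e ≤ c := by
  have hcont : ContinuousOn (fun t => e t ⬝ᵥ e t) (Set.Ici 0) := by
    have := continuousOn_pi.1 he
    simp only [dotProduct]
    fun_prop
  have hI : IntegrableOn (fun t => e t ⬝ᵥ e t) (Set.Ioi 0) volume := by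
    refine integrableOn_Ioi_of_intervalIntegral_norm_bounded (l := Filter.atTop)
      (b := fun T : ℝ => T) (c ^ 2) 0 (fun T => ?_) Filter.tendsto_id ?_
    · exact ((hcont.mono Set.Icc_subset_Ici_self).integrableOn_Icc).mono_set
        Set.Ioc_subset_Icc_self
    · filter_upwards [Filter.eventually_ge_atTop 0] with T hT
      refine le_trans (le_of_eq ?_) (hb T hT)
      refine intervalIntegral.integral_congr fun t _ => ?_
      exact Real.norm_of_nonneg (dotProduct_self_nonneg_real (e t))
  refine ⟨⟨he.aestronglyMeasurable measurableSet_Ici,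
    (integrableOn_Ici_iff_integrableOn_Ioi (by simp)).2 hI⟩, ?_⟩
  refine Real.sqrt_le_left hc |>.2 ?_
  rw [integral_Ici_eq_integral_Ioi]
  exact le_of_tendsto (intervalIntegral_tendsto_integral_Ioi 0 hI Filter.tendsto_id)
    (by filter_upwards [Filter.eventually_ge_atTop 0] with T hT using hb T hT)

theorem MemL2.intervalIntegrable {k : ℕ} {u : ℝ → (Fin k → ℝ)} (hu : MemL2 u) {t : ℝ}
    (ht : 0 ≤ t) : IntervalIntegrable u volume 0 t := by
  rw [intervalIntegrable_iff_integrableOn_Ioc_of_le ht]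
  have hsub : Set.Ioc 0 t ⊆ Set.Ici (0 : ℝ) := fun s hs => hs.1.le
  -- Local integrability follows from `|a| ≤ 1 + a²`.
  refine Integrable.mono' (g := fun s => 1 + u s ⬝ᵥ u s)
    ((integrable_const 1).add (hu.2.mono_set hsub))
    (hu.1.mono_measure (Measure.restrict_mono hsub le_rfl)) (ae_of_all _ fun s => ?_)
  have h0 := dotProduct_self_nonneg_real (u s)
  refine (pi_norm_le_iff_of_nonneg (by linarith)).2 fun i => ?_
  have h1 : u s i * u s i ≤ u s ⬝ᵥ u s :=
    Finset.single_le_sum (f := fun i => u s i * u s i) (fun j _ => mul_self_nonneg _)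
      (Finset.mem_univ i)
  rw [Real.norm_eq_abs]
  rcases abs_cases (u s i) with ⟨h, _⟩ | ⟨h, _⟩ <;> rw [h] <;>
    nlinarith [sq_nonneg (u s i - 1), sq_nonneg (u s i + 1)]

/-- The input `[u; c e^{-α t} z₀]`. -/
noncomputable def extendedInput {m q : ℕ} (u : ℝ → Fin m → ℝ) (α c : ℝ) (z₀ : Fin q → ℝ) :
    ℝ → (Fin m ⊕ Fin q) → ℝ :=
  fun t => Sum.elim (u t) ((c * Real.exp (-α * t)) • z₀)

variable {m q : ℕ} {u : ℝ → Fin m → ℝ} {α c : ℝ} {z₀ : Fin q → ℝ}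

theorem extendedInput_dotProduct_self (t : ℝ) :
    extendedInput u α c z₀ t ⬝ᵥ extendedInput u α c z₀ t
      = u t ⬝ᵥ u t + c ^ 2 * (z₀ ⬝ᵥ z₀) * Real.exp (-(2 * α) * t) := by
  have : Real.exp (-(2 * α) * t) = Real.exp (-α * t) * Real.exp (-α * t) := by
    rw [← Real.exp_add]; congr 1; ring
  rw [extendedInput, sumElim_dotProduct_sumElim, smul_dotProduct, dotProduct_smul, this]
  simp only [smul_eq_mul]
  ring

theorem MemL2.integrableOn_extendedInput (hu : MemL2 u) (hα : 0 < α) :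
    IntegrableOn (fun t => extendedInput u α c z₀ t ⬝ᵥ extendedInput u α c z₀ t)
      (Set.Ici 0) volume := by
  simp only [extendedInput_dotProduct_self]
  refine hu.2.add (Integrable.const_mul ?_ _)
  exact (integrableOn_Ici_iff_integrableOn_Ioi (by simp)).2 (integrableOn_exp_mul_Ioi (by linarith) 0)

/-- The factor `1/(2α)` is the integral of `e^{-2αt}`; it explains the scaling `c = β√(2α)`, for
which the second term becomes `β²‖z₀‖²`. -/
theorem MemL2.integral_extendedInput (hu : MemL2 u) (hα : 0 < α) :
    ∫ t in Set.Ici (0 : ℝ), extendedInput u α c z₀ t ⬝ᵥ extendedInput u α c z₀ t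
      = normL2 u ^ 2 + c ^ 2 / (2 * α) * (z₀ ⬝ᵥ z₀) := by
  have hexp : IntegrableOn (fun t => Real.exp (-(2 * α) * t)) (Set.Ici 0) volume :=
    (integrableOn_Ici_iff_integrableOn_Ioi (by simp)).2 (integrableOn_exp_mul_Ioi (by linarith) 0)
  simp only [extendedInput_dotProduct_self]
  rw [integral_add hu.2 (hexp.const_mul _), normL2_sq, integral_const_mul,
    integral_Ici_eq_integral_Ioi (f := fun t => Real.exp (-(2 * α) * t)),
    integral_exp_mul_Ioi (by linarith)]
  simp only [mul_zero, Real.exp_zero]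
  field_simp

theorem MemL2.intervalIntegrable_extendedInput (hu : MemL2 u) {t : ℝ} (ht : 0 ≤ t) :
    IntervalIntegrable (extendedInput u α c z₀) volume 0 t := by
  refine intervalIntegrable_pi_iff.2 ?_
  rintro (i | j)
  · exact intervalIntegrable_pi_iff.1 (hu.intervalIntegrable ht) i
  · refine Continuous.intervalIntegrable ?_ _ _
    simp only [extendedInput, Sum.elim_inr, Pi.smul_apply, smul_eq_mul]
    fun_prop

/-- Subtracting `e^{-α t} X z₀` turns the initial state into an additional input. -/
theorem IsStateTrajectory.shift {n : ℕ} {A : Matrix (Fin n) (Fin n) ℝ}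
    {B : Matrix (Fin n) (Fin m) ℝ} {X H : Matrix (Fin n) (Fin q) ℝ} {x : ℝ → Fin n → ℝ}
    (hx : IsStateTrajectory A B u (X *ᵥ z₀) x)
    (hH : (A + α • (1 : Matrix (Fin n) (Fin n) ℝ)) * X = H) (hc : c ≠ 0) :
    IsZeroTrajectory A (fromCols B ((1 / c) • H)) (extendedInput u α c z₀)
      (fun t => x t - Real.exp (-α * t) • (X *ᵥ z₀)) := by
  have p1 : IsPrimitive (fun s => A *ᵥ x s + B *ᵥ u s) (fun t => x t - X *ᵥ z₀) := by
    refine ⟨hx.1.sub continuousOn_const, fun t ht => ⟨(hx.2 t ht).1, ?_⟩⟩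
    simp only [(hx.2 t ht).2, add_sub_cancel_left]
  have p2 : IsPrimitive (fun s => (α * Real.exp (-α * s)) • (X *ᵥ z₀))
      (fun t => X *ᵥ z₀ - Real.exp (-α * t) • (X *ᵥ z₀)) := by
    have hcont : Continuous fun s => (α * Real.exp (-α * s)) • (X *ᵥ z₀) := by fun_prop
    refine ⟨Continuous.continuousOn (by fun_prop),
      fun t _ => ⟨hcont.intervalIntegrable _ _, ?_⟩⟩
    have hd : ∀ s, HasDerivAt (fun t => X *ᵥ z₀ - Real.exp (-α * t) • (X *ᵥ z₀))
        ((α * Real.exp (-α * s)) • (X *ᵥ z₀)) s := fun s => by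
      have h1 : HasDerivAt (fun t : ℝ => Real.exp (-α * t)) (Real.exp (-α * s) * (-α * 1)) s :=
        ((hasDerivAt_id s).const_mul (-α)).exp
      refine ((h1.smul_const (X *ᵥ z₀)).const_sub (X *ᵥ z₀)).congr_deriv ?_
      rw [← neg_smul]
      congr 1
      ring
    rw [intervalIntegral.integral_eq_sub_of_hasDerivAt (fun s _ => hd s)
      (hcont.intervalIntegrable _ _)]
    simp
  refine (p1.add p2).congr (fun t _ => ?_) fun t _ => by abel
  have e : H *ᵥ z₀ = A *ᵥ (X *ᵥ z₀) + α • (X *ᵥ z₀) := by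
    rw [← hH, ← mulVec_mulVec, add_mulVec, smul_mulVec, one_mulVec]
  rw [extendedInput, fromCols_mulVec_sumElim, smul_mulVec, mulVec_smul, smul_smul, e, mulVec_sub,
    mulVec_smul, ← mul_assoc, one_div_mul_cancel hc, one_mul, smul_add, smul_smul,
    mul_comm (Real.exp _) α]
  abel

end Infinite

/-! ### Assembling the theorem -/

section Main

theorem mul_nonsing_inv_of_not_hasEigenvalue {r : ℕ} {a : Matrix (Fin r) (Fin r) ℝ} {α : ℝ}
    (h : ¬ Module.End.HasEigenvalue (Matrix.toLin' a) (-α)) :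
    (a + α • (1 : Matrix (Fin r) (Fin r) ℝ)) * (a + α • (1 : Matrix (Fin r) (Fin r) ℝ))⁻¹ = 1 := by
  refine mul_nonsing_inv _ (isUnit_iff_ne_zero.2 fun hdet => h ?_)
  obtain ⟨v, hv0, hv⟩ := exists_mulVec_eq_zero_iff.2 hdet
  refine Module.End.hasEigenvalue_of_hasEigenvector
    (x := v) ⟨Module.End.mem_eigenspace_iff.2 ?_, hv0⟩
  rw [add_mulVec, smul_mulVec, one_mulVec] at hv
  rw [Matrix.toLin'_apply, neg_smul]
  exact eq_neg_of_add_eq_zero_left hv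

theorem IsStateTrajectory.apply_zero {n m : ℕ} {A : Matrix (Fin n) (Fin n) ℝ}
    {B : Matrix (Fin n) (Fin m) ℝ} {u : ℝ → (Fin m → ℝ)} {x₀ : Fin n → ℝ} {x : ℝ → (Fin n → ℝ)}
    (hx : IsStateTrajectory A B u x₀ x) : x 0 = x₀ := by
  simpa using (hx.2 0 le_rfl).2

end Main

end ShiftBT

theorem theorem1 {n m p q r : ℕ} (hr : 0 < r) (hrn : r < n)
    (A : Matrix (Fin n) (Fin n) ℝ) (B : Matrix (Fin n) (Fin m) ℝ)
    (C : Matrix (Fin p) (Fin n) ℝ) (D : Matrix (Fin p) (Fin m) ℝ)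
    (X₀ : Matrix (Fin n) (Fin q) ℝ)
    (hA : ShiftBT.IsAsymptoticallyStable A)
    (α β : ℝ) (hα : 0 < α) (hβ : 0 < β)
    (V W : Matrix (Fin n) (Fin r) ℝ) (η : Fin n → ℝ)
    (hBT : ShiftBT.IsBalancedTruncation A (ShiftBT.expandedInput A B X₀ α β) C hrn.le V W η)
    (hgap : η ⟨r - 1, by omega⟩ > η ⟨r, hrn⟩)
    (M : ShiftBT.ReducedModel r m p q) (hM : M = ShiftBT.jShiftBT A B C D X₀ α V W)
    (hspec : ¬ Module.End.HasEigenvalue (Matrix.toLin' M.A) (-α)) :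
    ShiftBT.IsAsymptoticallyStable M.A ∧
    ∀ (z₀ : Fin q → ℝ) (u : ℝ → (Fin m → ℝ))
      (x : ℝ → (Fin n → ℝ)) (xr : ℝ → (Fin r → ℝ)) (y yr : ℝ → (Fin p → ℝ)),
      ShiftBT.IsStateTrajectory A B u (X₀ *ᵥ z₀) x →
      (∀ t, 0 ≤ t → y t = C *ᵥ x t + D *ᵥ u t) →
      ShiftBT.IsStateTrajectory M.A M.B u (M.X₀ *ᵥ z₀) xr →
      (∀ t, 0 ≤ t → yr t = M.C *ᵥ xr t + M.D *ᵥ u t + M.f z₀ t) →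
      yr 0 = y 0 ∧
      (ShiftBT.MemL2 u →
        ShiftBT.MemL2 (fun t => y t - yr t) ∧
        ShiftBT.normL2 (fun t => y t - yr t) ≤
          2 * (∑ i ∈ Finset.univ.filter (fun i : Fin n => r ≤ (i : ℕ)), η i) *
            (ShiftBT.normL2 u + β * ‖(WithLp.toLp 2 z₀ : EuclideanSpace ℝ (Fin q))‖)) := by
  subst hM
  obtain ⟨hanti, hη, P, Q, R, L, U, Z, hP, hQ, hPR, hQL, hU, hZ, hsvd, hV, hW⟩ := hBT
  have hdata : ShiftBT.IsBalancingData A (ShiftBT.expandedInput A B X₀ α β) C P Q R L U Z η :=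
    ⟨hP, hQ, hPR, hQL, (mem_orthogonalGroup_iff' _ _).1 hU, (mem_orthogonalGroup_iff' _ _).1 hZ, hsvd⟩
  have hlast : ∀ i : Fin r, η ⟨r, hrn⟩ < η (Fin.castLE hrn.le i) := fun i =>
    hgap.lt.trans_le (hanti (Fin.le_def.2 (Nat.le_sub_one_of_lt i.2)))
  have hpos : ∀ i : Fin r, 0 < η (Fin.castLE hrn.le i) := fun i => (hη _).trans_lt (hlast i)
  have hVb : V = ShiftBT.balancingBasis hrn.le R Z η := hV
  have hWb : W = ShiftBT.balancingBasis hrn.le L U η := hW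
  have hAr : (ShiftBT.jShiftBT A B C D X₀ α V W).A = Wᵀ * A * V := rfl
  have hBr : (ShiftBT.jShiftBT A B C D X₀ α V W).B = Wᵀ * B := rfl
  have hCr : (ShiftBT.jShiftBT A B C D X₀ α V W).C = C * V := rfl
  have hDr : (ShiftBT.jShiftBT A B C D X₀ α V W).D = D := rfl
  have hXr : (ShiftBT.jShiftBT A B C D X₀ α V W).X₀ = ShiftBT.reducedInitialMap A X₀ α V W := rfl
  have hfr : ∀ z t, (ShiftBT.jShiftBT A B C D X₀ α V W).f z t = Real.exp (-α * t) •
    ((C * X₀ - (C * V) * ShiftBT.reducedInitialMap A X₀ α V W) *ᵥ z) := fun _ _ => rfl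
  simp only [hAr, hBr, hCr, hDr, hXr, hfr] at hspec ⊢
  refine ⟨?_, fun z₀ u x xr y yr hx hy hxr hyr => ⟨?_, fun hu => ?_⟩⟩
  · rw [hVb, hWb]
    exact hdata.isAsymptoticallyStable_reduced hA hη hrn.le hpos
      fun i j hj => (hanti (Fin.le_def.2 hj)).trans_lt (hlast i)
  · rw [hyr 0 le_rfl, hy 0 le_rfl, hx.apply_zero, hxr.apply_zero]
    simp only [mul_zero, Real.exp_zero, one_smul, sub_mulVec, mulVec_mulVec]
    abel
  have hγ : β * Real.sqrt (2 * α) ≠ 0 :=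
    mul_ne_zero hβ.ne' (Real.sqrt_pos.2 (by linarith)).ne'
  -- The choice of `X_{0,r}` makes the reduced exponential forcing the projection of the full one;
  -- this is where `-α` must not be an eigenvalue of `A_r`.
  have hX : (Wᵀ * A * V + α • (1 : Matrix (Fin r) (Fin r) ℝ)) *
      ShiftBT.reducedInitialMap A X₀ α V W
      = Wᵀ * ((A + α • (1 : Matrix (Fin n) (Fin n) ℝ)) * X₀) := by
    rw [ShiftBT.reducedInitialMap, ← Matrix.mul_assoc,
      ShiftBT.mul_nonsing_inv_of_not_hasEigenvalue hspec, Matrix.one_mul, Matrix.mul_assoc]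
  have tx := hx.shift (α := α) rfl hγ
  have txr := hxr.shift hX hγ
  have hBt : fromCols (Wᵀ * B) ((1 / (β * Real.sqrt (2 * α))) •
      (Wᵀ * ((A + α • (1 : Matrix (Fin n) (Fin n) ℝ)) * X₀)))
      = Wᵀ * ShiftBT.expandedInput A B X₀ α β := by
    rw [ShiftBT.expandedInput, mul_fromCols, Matrix.mul_smul]
  rw [hBt] at txr
  set w := ShiftBT.extendedInput u α (β * Real.sqrt (2 * α)) z₀ with hw
  have herr : ∀ t, 0 ≤ t → y t - yr t =
      C *ᵥ (x t - Real.exp (-α * t) • (X₀ *ᵥ z₀)) - (C * V) *ᵥ (xr t -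
        Real.exp (-α * t) • (ShiftBT.reducedInitialMap A X₀ α V W *ᵥ z₀)) := fun t ht => by
    rw [hy t ht, hyr t ht]
    simp only [mulVec_sub, sub_mulVec, mulVec_smul, mulVec_mulVec, smul_sub, Matrix.mul_assoc]
    abel
  set S := ∑ i ∈ Finset.univ.filter (fun i : Fin n => r ≤ (i : ℕ)), η i with hS
  have hS0 : 0 ≤ S := Finset.sum_nonneg fun i _ => hη i
  set N := ‖(WithLp.toLp 2 z₀ : EuclideanSpace ℝ (Fin q))‖ with hN
  have hNz : z₀ ⬝ᵥ z₀ = N ^ 2 := by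
    rw [hN, EuclideanSpace.real_norm_sq_eq]
    simp [dotProduct, sq]
  have hN0 : 0 ≤ N := norm_nonneg _
  have hu0 : 0 ≤ ShiftBT.normL2 u := Real.sqrt_nonneg _
  have hw2 := hu.integrableOn_extendedInput (c := β * Real.sqrt (2 * α)) (z₀ := z₀) hα
  have hw2' : ∀ t, 0 ≤ t → IntervalIntegrable (fun t => w t ⬝ᵥ w t) volume 0 t := fun t ht =>
    (intervalIntegrable_iff_integrableOn_Ioc_of_le ht).2 (hw2.mono_set fun s hs => hs.1.le)
  have hwint : ∫ t in Set.Ici (0 : ℝ), w t ⬝ᵥ w t = ShiftBT.normL2 u ^ 2 + (β * N) ^ 2 := by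
    rw [hw, hu.integral_extendedInput hα, hNz, mul_pow, Real.sq_sqrt (by linarith)]
    field_simp
  refine ShiftBT.memL2_and_normL2_le_of_forall_integral_le
    (mul_nonneg (by linarith) (add_nonneg hu0 (mul_nonneg hβ.le hN0))) ?_ fun T hT => ?_
  -- The error is continuous although `y` and `y_r` need not be, since `D u` has cancelled.
  · exact ((ShiftBT.IsPrimitive.mulVec tx C).1.sub
      (ShiftBT.IsPrimitive.mulVec txr (C * V)).1).congr herr
  · have e1 : ∫ t in (0 : ℝ)..T, (y t - yr t) ⬝ᵥ (y t - yr t) ≤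
        (2 * S) ^ 2 * ∫ t in (0 : ℝ)..T, w t ⬝ᵥ w t := by
      subst hVb hWb
      refine le_trans (le_of_eq (intervalIntegral.integral_congr fun t ht => ?_))
        (hdata.integral_output_error_le hanti hη hrn.le hpos tx txr
          (fun t ht => hu.intervalIntegrable_extendedInput ht) hw2' hT)
      rw [Set.uIcc_of_le hT] at ht
      simp only [herr t ht.1]
    have e2 : ∫ t in (0 : ℝ)..T, w t ⬝ᵥ w t ≤ ShiftBT.normL2 u ^ 2 + (β * N) ^ 2 := by
      rw [← hwint, intervalIntegral.integral_of_le hT]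
      exact setIntegral_mono_set hw2
        (ae_of_all _ fun t => ShiftBT.dotProduct_self_nonneg_real (w t))
        (ae_of_all _ fun s (hs : s ∈ Set.Ioc 0 T) => hs.1.le)
    refine e1.trans ((mul_le_mul_of_nonneg_left e2 (sq_nonneg _)).trans ?_)
    rw [mul_pow (2 * S)]
    refine mul_le_mul_of_nonneg_left ?_ (sq_nonneg _)
    nlinarith [mul_nonneg hu0 (mul_nonneg hβ.le hN0)]
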